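/- Let $d\ge 1$ and let $P\subset\mathbb{Z}^d$ be an infinite set of zero upper Banach density, i.e. $$\limsup_{n_1,\dots,n_d\to\infty}\ \sup_{r\in\mathbb{Z}^d}\frac{|P\cap[r_1,r_1+n_1)\times\cdots\times[r_d,r_d+n_d)|}{n_1\cdots n_d}=0 .$$ For a finite set $C\subset\mathbb{R}$, a subshift over $C$ is a closed set $X\subset C^{\mathbb{Z}^d}$ invariant under the shift action $(T^gx)(h)=x(g+h)$ of $\mathbb{Z}^d$; its topological entropy is $\lim_{n\to\infty} n^{-d}\log|\{x|_{[0,n)^d} : x\in X\}|$. It is totally strictly ergodic if, for every subgroup $F<\mathbb{Z}^d$ of finite index, every $F$-orbit is dense in $X$ and there is exactly one $F$-invariant Borel probability measure on $X$. Say that $X$ is $P$-oscillating if, for the continuous function $f(x)=x(0)$ on $X$, the averages $$\frac{1}{|P\cap(-n,n)^d|}\sum_{g\in P\cap(-n,n)^d}f(T^gx)$$ fail to converge as $n\to\infty$ for a residual set of $x\in X$ and, in fact, have lower limit $0$ and upper limit $1$ for a residual set of $x\in X$. (a) There is a totally strictly ergodic, $P$-oscillating subshift over $\{0,1\}$. (b)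 For every real $M$ there are a finite set $C$ with $\{0,1\}\subset C\subset[0,1]$ and a totally strictly ergodic, $P$-oscillating subshift over $C$ whose topological entropy is at least $M$. -/

import Mathlib

open Filter Topology MeasureTheory
open SymbolicDynamics.FullShift (Subshift shift)

noncomputable section

/-! ### Actions of groups -/

/-- An action is uniquely ergodic if it has exactly one invariant probability measure. -/
def IsUniquelyErgodic (G X : Type*) [AddGroup G] [AddAction G X] [MeasurableSpace X] : Prop :=
  ∃! μ : Measure X, IsProbabilityMeasure μ ∧ VAddInvariantMeasure G X μ

/-- An action is strictly ergodic if it is minimal (every orbit is dense) and uniquely ergodic. -/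
def IsStrictlyErgodic (G X : Type*) [AddGroup G] [AddAction G X]
    [TopologicalSpace X] [MeasurableSpace X] : Prop :=
  AddAction.IsMinimal G X ∧ IsUniquelyErgodic G X

/-- An action of `G` is totally strictly ergodic if its restriction to every subgroup of finite
index (`G` itself included) is strictly ergodic. -/
def IsTotallyStrictlyErgodic (G X : Type*) [AddGroup G] [AddAction G X]
    [TopologicalSpace X] [MeasurableSpace X] : Prop :=
  ∀ F : AddSubgroup G, F.FiniteIndex → IsStrictlyErgodic F X

/-! ### Subshifts over a commutative group -/

/-- The shift action on a subshift, `(g +ᵥ x) h = x (g + h)`. -/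
instance subshiftAddAction {A G : Type*} [TopologicalSpace A] [AddCommGroup G]
    (X : Subshift A G) : AddAction G X.carrier where
  vadd g x := ⟨shift g x.1, X.mapsTo g x.2⟩
  zero_vadd x := Subtype.ext (funext fun h => congrArg x.1 (zero_add h))
  add_vadd g₁ g₂ x := Subtype.ext (funext fun h => congrArg x.1 (by
    rw [add_comm g₁ g₂, add_assoc]))

/-! ### Boxes and densities in `ℤ^d` -/

/-- The box `[r₁, r₁ + n₁) × ⋯ × [r_d, r_d + n_d)` in `ℤ^d`. -/
def latticeBox {d : ℕ} (r : Fin d → ℤ) (n : Fin d → ℕ) : Finset (Fin d → ℤ) :=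
  Fintype.piFinset fun i => Finset.Ico (r i) (r i + n i)

open Classical in
/-- The upper Banach density of `P`: the limsup, as all side lengths `n₁, …, n_d` tend to
infinity, of the largest proportion of `P` in a box with these side lengths. The proportions lie in
`[0, 1]`, so the supremum and the limsup are taken of bounded families. -/
def upperBanachDensity {d : ℕ} (P : Set (Fin d → ℤ)) : ℝ :=
  limsup (fun n : Fin d → ℕ => ⨆ r : Fin d → ℤ,
    (((latticeBox r n).filter (· ∈ P)).card : ℝ) / ∏ i, (n i : ℝ)) atTop

open Classical in
/-- The finite set `P ∩ (-n, n)^d`. -/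
def centralPart {d : ℕ} (P : Set (Fin d → ℤ)) (n : ℕ) : Finset (Fin d → ℤ) :=
  (Fintype.piFinset fun _ : Fin d => Finset.Ioo (-(n : ℤ)) n).filter (· ∈ P)

/-- The average of `f (T^g x)` over `g ∈ P ∩ (-n, n)^d`. -/
def averageAlong {d : ℕ} {X : Type*} [AddAction (Fin d → ℤ) X] (P : Set (Fin d → ℤ))
    (f : X → ℝ) (n : ℕ) (x : X) : ℝ :=
  (∑ g ∈ centralPart P n, f (g +ᵥ x)) / ((centralPart P n).card : ℝ)

/-! ### Topological entropy of a subshift -/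

/-- The patterns with support `[0, n)^d` that occur in points of the subshift `X`. -/
def patternsOnCube {d : ℕ} {A : Type*} [TopologicalSpace A] (X : Subshift A (Fin d → ℤ)) (n : ℕ) :
    Set (latticeBox (0 : Fin d → ℤ) (fun _ => n) → A) :=
  (fun x g => x g) '' X.carrier

/-- The subshift `X` has topological entropy `h`: the numbers `log |patterns on [0, n)^d| / n^d`
converge to `h`. -/
def HasTopologicalEntropy {d : ℕ} {A : Type*} [TopologicalSpace A] (X : Subshift A (Fin d → ℤ))
    (h : ℝ) : Prop :=
  Tendsto (fun n : ℕ => Real.log (patternsOnCube X n).ncard / (n : ℝ) ^ d) atTop (𝓝 h)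

/-! ### Oscillating averages -/

/-- For a residual set of points `x`, the averages of `f (T^g x)` over `g ∈ P ∩ (-n, n)^d` fail to
converge as `n → ∞`; in fact their lower limit is `0` and their upper limit is `1`. -/
def AveragesOscillate {d : ℕ} {X : Type*} [AddAction (Fin d → ℤ) X] [TopologicalSpace X]
    (P : Set (Fin d → ℤ)) (f : X → ℝ) : Prop :=
  (∀ᶠ x in residual X, ¬ ∃ L : ℝ, Tendsto (fun n => averageAlong P f n x) atTop (𝓝 L)) ∧
  (∀ᶠ x in residual X, liminf (fun n => averageAlong P f n x) atTop = 0 ∧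
    limsup (fun n => averageAlong P f n x) atTop = 1)

end

/-!
The subshift is defined by a hierarchy of finite sets of blocks, i.e. of patterns on the cubes
`[0, n_k)^d`. The blocks of stage `0` are the single symbols. A block of stage `k + 1` is a pattern
with blocks of stage `k` in all slots, a product arrangement of disjoint cubes, such that every
block of stage `k` occurs with nearly the same frequency among the slots of each residue class
modulo `k!` (`IsBalanced`, `Stage.next`). The points of the subshift are the configurations all of
whose finite patterns occur inside blocks.

* *Total strict ergodicity.* In each coordinate the slots leave out one point, so that
  `n_{k+1} = 2 * L * n_k + 1` with `(k + 1)!` dividing `L`. Hence `n_k` is `1` modulo `k!` for all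
  `k`, and the slots are equidistributed modulo `k!` (`card_filter_residue_slotPos`). This removes
  the odometer which a rigid subdivision would produce as a factor. A subgroup of finite index
  contains `(k!ℤ)^d` for large `k`. Every block of stage `k + 1` contains all blocks of stage `k` at
  positions of all residues modulo `k!`, which gives minimality; moreover, all blocks of stage
  `k + 1` have nearly the same averages over the points of `(k!ℤ)^d`, wherever they are placed
  (`eventually_abs_latticeSum_block_le`). The omitted point lies in the middle, so that the gaps of
  different stages do not add up, and large cubes are nearly tiled by blocks of any given stage
  (`exists_positions`, `exists_disjoint_blocks`). Thus lattice averages of local functions converge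
  uniformly to constants, and there is only one invariant measure.
* *Oscillation.* As `P` has zero Banach density, it meets only a small proportion of the slots of a
  block if `L` is large. Blocks in few slots can be exchanged without spoiling the balance. By
  induction there are blocks with prescribed symbols on `P`, and every block extends to a point of
  the subshift with prescribed symbols on the rest of `P` (`Admissible.exists_extension`,
  `exists_mem_of_isBlock`). So points with averages converging to `0`, or to `1`, are dense, and a
  Baire category argument finishes the proof.
* *Entropy.* By the weak law of large numbers at least half of all arrangements of blocks in the
  slots are balanced (`card_le_two_mul_card_isBalanced`). Therefore the entropy is at least
  `log (|A| / 2) / 2 ^ d` for the alphabet `A` (`le_entropy`).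
-/

noncomputable section

/-! ### Balanced colourings -/

open Classical in
/-- A colouring `u` of a finite set `J` whose points are sorted into classes by `cls` is balanced
up to the relative error `ε` if each colour `v ∈ V` occurs in each class `M / |V|` times, up to
the factor `1 ± ε`. Here `M` is meant to be the common size of the classes. The inequality is
multiplied by `|V|`. -/
def IsBalanced {J R T : Type*} [Fintype J] (cls : J → R) (V : Finset T) (M ε : ℝ) (u : J → T) :
    Prop :=
  ∀ ρ, ∀ v ∈ V,
    |(V.card : ℝ) * ((Finset.univ.filter fun j => cls j = ρ ∧ u j = v).card : ℝ) - M| ≤ ε * M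

open Classical in
/-- Changing a balanced colouring at few points keeps it balanced, with a larger error. -/
lemma IsBalanced.of_eqOn {J R T : Type*} [Fintype J] {cls : J → R} {V : Finset T} {M ε δ : ℝ}
    {u u' : J → T} (hu : IsBalanced cls V M ε u) (D : Finset J) (hD : ∀ j ∉ D, u' j = u j)
    (hcard : (V.card : ℝ) * D.card ≤ δ * M) : IsBalanced cls V M (ε + δ) u' := by
  intro ρ v hv
  have key : ∀ a b : J → T, (∀ j ∉ D, a j = b j) →
      ((Finset.univ.filter fun j => cls j = ρ ∧ a j = v).card : ℝ) ≤
        (Finset.univ.filter fun j => cls j = ρ ∧ b j = v).card + D.card := by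
    intro a b hab
    rw [← Nat.cast_add]
    refine Nat.cast_le.2 ((Finset.card_le_card ?_).trans (Finset.card_union_le _ _))
    intro j hj
    by_cases hjD : j ∈ D
    · exact Finset.mem_union_right _ hjD
    · refine Finset.mem_union_left _ ?_
      simpa [← hab j hjD] using hj
  have h1 := key u' u hD
  have h2 := key u u' fun j hj => (hD j hj).symm
  have h3 := abs_le.1 (hu ρ v hv)
  have hV : (0 : ℝ) ≤ V.card := Nat.cast_nonneg _
  have h4 := mul_le_mul_of_nonneg_left h1 hV
  have h5 := mul_le_mul_of_nonneg_left h2 hV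
  rw [abs_le]
  constructor <;> nlinarith

open Classical in
/-- In a balanced colouring each colour occurs in each class. -/
lemma IsBalanced.exists_eq {J R T : Type*} [Fintype J] {cls : J → R} {V : Finset T} {M ε : ℝ}
    {u : J → T} (hu : IsBalanced cls V M ε u) (hε : ε < 1) (hM : 0 < M) (ρ : R) {v : T}
    (hv : v ∈ V) : ∃ j, cls j = ρ ∧ u j = v := by
  have h := hu ρ v hv
  by_contra hno
  push Not at hno
  rw [Finset.filter_eq_empty_iff.2 fun j _ hj => hno j hj.1 hj.2] at h
  simp only [Finset.card_empty, Nat.cast_zero, mul_zero, zero_sub, abs_neg, abs_of_pos hM] at h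
  nlinarith

/-- Distinct coordinates of a random colouring are uncorrelated. -/
lemma sum_mul_eq_zero_of_ne {J V : Type*} [Fintype J] [DecidableEq J] [Fintype V] (φ : V → ℝ)
    (hφ : ∑ v, φ v = 0) {i j : J} (hij : i ≠ j) : ∑ u : J → V, φ (u i) * φ (u j) = 0 := by
  have h := Finset.prod_univ_sum (fun _ : J => (Finset.univ : Finset V))
    (fun l v => if l = i ∨ l = j then φ v else 1)
  rw [Fintype.piFinset_univ] at h
  have h0 : ∏ l : J, ∑ v : V, (if l = i ∨ l = j then φ v else 1) = 0 :=
    Finset.prod_eq_zero (Finset.mem_univ i) (by simpa using hφ)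
  rw [h0] at h
  rw [h]
  refine Finset.sum_congr rfl fun u _ => ?_
  rw [Finset.prod_ite, Finset.prod_const_one, mul_one]
  have : (Finset.univ.filter fun l => l = i ∨ l = j) = {i, j} := by
    ext l; simp
  rw [this, Finset.prod_pair hij]

/-- The second moment of a sum of centred functions of the coordinates. -/
lemma sum_sq_sum_le {J V : Type*} [Fintype J] [DecidableEq J] [Fintype V] (φ : V → ℝ)
    (hφ : ∑ v, φ v = 0) (hb : ∀ v, |φ v| ≤ 1) (S : Finset J) :
    ∑ u : J → V, (∑ j ∈ S, φ (u j)) ^ 2 ≤ S.card * (Fintype.card V : ℝ) ^ Fintype.card J := by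
  have h1 : ∀ u : J → V, (∑ j ∈ S, φ (u j)) ^ 2 = ∑ i ∈ S, ∑ j ∈ S, φ (u i) * φ (u j) := by
    intro u; rw [sq, Finset.sum_mul_sum]
  simp_rw [h1]
  rw [Finset.sum_comm]
  have h2 : ∀ i ∈ S, ∑ u : J → V, ∑ j ∈ S, φ (u i) * φ (u j) ≤
      (Fintype.card V : ℝ) ^ Fintype.card J := by
    intro i hi
    rw [Finset.sum_comm, Finset.sum_eq_single i]
    · calc ∑ u : J → V, φ (u i) * φ (u i) ≤ ∑ _u : J → V, (1 : ℝ) := by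
            refine Finset.sum_le_sum fun u _ => ?_
            have := abs_le.1 (hb (u i))
            nlinarith
        _ = _ := by simp
    · intro j _ hj
      exact sum_mul_eq_zero_of_ne φ hφ hj.symm
    · exact fun h => absurd hi h
  calc _ ≤ ∑ i ∈ S, (Fintype.card V : ℝ) ^ Fintype.card J := Finset.sum_le_sum h2
    _ = _ := by rw [Finset.sum_const, nsmul_eq_mul]

open Classical in
/-- A weak law of large numbers: if the classes are large, at least half of all colourings are
balanced. The proof is Chebyshev's inequality and a union bound over the classes and colours. -/
lemma card_le_two_mul_card_isBalanced {J R T : Type*} [Fintype J] [Fintype R]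
    (cls : J → R) (V : Finset T) {M : ℕ} {ε : ℝ}
    (hcls : ∀ ρ, (Finset.univ.filter fun j => cls j = ρ).card = M) (hε : 0 < ε) (hM : 0 < M)
    (hV : V.Nonempty) (hlarge : 2 * (Fintype.card R : ℝ) * (V.card : ℝ) ^ 3 ≤ ε ^ 2 * M) :
    V.card ^ Fintype.card J ≤
      2 * (Finset.univ.filter fun u : J → V => IsBalanced cls V M ε fun j => (u j : T)).card := by
  set v₀ : ℝ := (V.card : ℝ) with hv₀
  have hVpos : 0 < v₀ := by rw [hv₀]; exact_mod_cast hV.card_pos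
  have hMpos : (0 : ℝ) < M := by exact_mod_cast hM
  set tot : ℝ := v₀ ^ Fintype.card J with htot
  have htotpos : 0 < tot := by positivity
  -- the colourings for which the inequality fails at the class `ρ` and the colour `v`
  let bad : R × V → Finset (J → V) := fun p => Finset.univ.filter fun u =>
    ε * M < |v₀ * ((Finset.univ.filter fun j => cls j = p.1 ∧ u j = p.2).card : ℝ) - M|
  have hbad : ∀ p, ((bad p).card : ℝ) * (ε ^ 2 * M) ≤ v₀ ^ 2 * tot := by
    rintro ⟨ρ, v⟩
    let S : Finset J := Finset.univ.filter fun j => cls j = ρ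
    have hSc : S.card = M := hcls ρ
    let φ : V → ℝ := fun w => (if w = v then 1 else 0) - 1 / v₀
    have hφ : ∑ w, φ w = 0 := by
      simp only [φ, Finset.sum_sub_distrib, Finset.sum_ite_eq', Finset.mem_univ, if_true,
        Finset.sum_const, Finset.card_univ, Fintype.card_coe, nsmul_eq_mul, ← hv₀]
      field_simp; simp
    have hone : 1 / v₀ ≤ 1 := by
      rw [div_le_one hVpos, hv₀]; exact_mod_cast hV.card_pos
    have hb : ∀ w, |φ w| ≤ 1 := by
      intro w
      have : 0 < 1 / v₀ := by positivity
      simp only [φ]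
      split_ifs <;> rw [abs_le] <;> constructor <;> linarith
    have hsum := sum_sq_sum_le φ hφ hb S
    rw [Fintype.card_coe, ← hv₀, hSc] at hsum
    have hcount : ∀ u : J → V, v₀ * ∑ j ∈ S, φ (u j) =
        v₀ * ((Finset.univ.filter fun j => cls j = ρ ∧ u j = v).card : ℝ) - M := by
      intro u
      simp only [φ, Finset.sum_sub_distrib, Finset.sum_const, nsmul_eq_mul, hSc, S,
        Finset.sum_ite, Finset.filter_filter]
      field_simp; simp
    have hlow : ((bad (ρ, v)).card : ℝ) * (ε * M) ^ 2 ≤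
        ∑ u : J → V, (v₀ * ∑ j ∈ S, φ (u j)) ^ 2 := by
      calc ((bad (ρ, v)).card : ℝ) * (ε * M) ^ 2
          = ∑ u ∈ bad (ρ, v), (ε * M) ^ 2 := by rw [Finset.sum_const, nsmul_eq_mul]
        _ ≤ ∑ u ∈ bad (ρ, v), (v₀ * ∑ j ∈ S, φ (u j)) ^ 2 := by
            refine Finset.sum_le_sum fun u hu => ?_
            have hu' := (Finset.mem_filter.1 hu).2
            rw [hcount u, ← sq_abs (_ - _)]
            exact pow_le_pow_left₀ (by positivity) hu'.le 2
        _ ≤ _ := Finset.sum_le_sum_of_subset_of_nonneg (Finset.subset_univ _)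
            fun _ _ _ => sq_nonneg _
    simp_rw [mul_pow v₀, ← Finset.mul_sum] at hlow
    have h1 := hlow.trans (mul_le_mul_of_nonneg_left hsum (sq_nonneg v₀))
    have h2 : (((bad (ρ, v)).card : ℝ) * (ε ^ 2 * M)) * M ≤ (v₀ ^ 2 * tot) * M := by
      calc _ = ((bad (ρ, v)).card : ℝ) * (ε * M) ^ 2 := by ring
        _ ≤ _ := h1
        _ = _ := by ring
    exact le_of_mul_le_mul_right h2 hMpos
  let good := Finset.univ.filter fun u : J → V => IsBalanced cls V M ε fun j => (u j : T)
  have hcover : (Finset.univ : Finset (J → V)) ⊆ good ∪ Finset.univ.biUnion bad := by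
    intro u _
    by_cases hu : IsBalanced cls V M ε fun j => (u j : T)
    · exact Finset.mem_union_left _ (Finset.mem_filter.2 ⟨Finset.mem_univ _, hu⟩)
    · refine Finset.mem_union_right _ ?_
      simp only [IsBalanced, not_forall, not_le] at hu
      obtain ⟨ρ, v, hv, h⟩ := hu
      refine Finset.mem_biUnion.2 ⟨(ρ, ⟨v, hv⟩), Finset.mem_univ _, ?_⟩
      refine Finset.mem_filter.2 ⟨Finset.mem_univ _, ?_⟩
      simpa [Subtype.ext_iff] using h
  have hc1 : tot ≤ good.card + ∑ p, ((bad p).card : ℝ) := by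
    have h := (Finset.card_le_card hcover).trans (Finset.card_union_le _ _)
    have h' := h.trans (Nat.add_le_add_left Finset.card_biUnion_le _)
    rw [Finset.card_univ, Fintype.card_fun, Fintype.card_coe] at h'
    rw [htot, hv₀]
    exact_mod_cast h'
  have hc2 : (∑ p, ((bad p).card : ℝ)) * (ε ^ 2 * M) ≤ (Fintype.card R * v₀) * (v₀ ^ 2 * tot) := by
    rw [Finset.sum_mul]
    refine (Finset.sum_le_sum fun p _ => hbad p).trans ?_
    rw [Finset.sum_const, nsmul_eq_mul, Finset.card_univ, Fintype.card_prod, Fintype.card_coe]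
    push_cast
    rfl
  have hc3 : (∑ p, ((bad p).card : ℝ)) ≤ tot / 2 := by
    refine le_of_mul_le_mul_right (hc2.trans ?_) (show 0 < ε ^ 2 * M by positivity)
    nlinarith
  have : tot ≤ 2 * (good.card : ℝ) := by linarith
  rw [htot, hv₀] at this
  exact_mod_cast this

/-! ### Cubes, residues and slots -/

/-- The cube `g + [0, n)^d`. -/
def cube {d : ℕ} (g : Fin d → ℤ) (n : ℕ) : Finset (Fin d → ℤ) := latticeBox g fun _ => n

lemma mem_cube {d : ℕ} {g h : Fin d → ℤ} {n : ℕ} :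
    h ∈ cube g n ↔ ∀ a, g a ≤ h a ∧ h a < g a + n := by
  simp [cube, latticeBox, Fintype.mem_piFinset]

lemma card_cube {d : ℕ} (g : Fin d → ℤ) (n : ℕ) : (cube g n).card = n ^ d := by
  simp [cube, latticeBox, Fintype.card_piFinset]

lemma add_mem_cube {d : ℕ} {g r h : Fin d → ℤ} {n : ℕ} :
    g + h ∈ cube (g + r) n ↔ h ∈ cube r n := by
  simp only [mem_cube, Pi.add_apply]
  refine forall_congr' fun a => ⟨fun ⟨_, _⟩ => ⟨?_, ?_⟩, fun ⟨_, _⟩ => ⟨?_, ?_⟩⟩ <;> omega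

/-- The residue class of `g ∈ ℤ^d` modulo `q`. -/
def residue {d : ℕ} (q : ℕ) (g : Fin d → ℤ) : Fin d → ZMod q := fun a => (g a : ZMod q)

lemma residue_add {d : ℕ} (q : ℕ) (g h : Fin d → ℤ) :
    residue q (g + h) = residue q g + residue q h := by
  ext a; simp [residue]

lemma card_filter_range_cast_eq {q L : ℕ} [NeZero q] (hq : q ∣ L) (r : ZMod q) :
    ((Finset.range L).filter fun j : ℕ => (j : ZMod q) = r).card = L / q := by
  obtain ⟨t, rfl⟩ := hq
  have hq0 : 0 < q := Nat.pos_of_ne_zero (NeZero.ne q)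
  rw [Nat.mul_div_cancel_left _ hq0]
  induction t with
  | zero => simp
  | succ t ih =>
    simp only [Finset.card_filter] at ih ⊢
    rw [Nat.mul_succ, Finset.sum_range_add, ih]
    congr 1
    rw [← Finset.card_filter, Finset.card_eq_one]
    refine ⟨r.val, Finset.ext fun j => ?_⟩
    simp only [Finset.mem_filter, Finset.mem_range, Finset.mem_singleton, Nat.cast_add,
      Nat.cast_mul, CharP.cast_eq_zero, zero_mul, zero_add]
    constructor
    · rintro ⟨h1, h2⟩
      rw [← h2, ZMod.val_natCast, Nat.mod_eq_of_lt h1]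
    · rintro rfl
      exact ⟨ZMod.val_lt r, ZMod.natCast_zmod_val r⟩

lemma card_filter_cube_residue_eq {d q N : ℕ} [NeZero q] (hq : q ∣ N) (g : Fin d → ℤ)
    (ρ : Fin d → ZMod q) :
    ((cube g N).filter fun h => residue q h = ρ).card = (N / q) ^ d := by
  have h1 : ((cube g N).filter fun h => residue q h = ρ) = Fintype.piFinset fun a =>
      (Finset.Ico (g a) (g a + N)).filter fun t : ℤ => (t : ZMod q) = ρ a := by
    ext h
    simp only [Finset.mem_filter, mem_cube, Fintype.mem_piFinset, Finset.mem_Ico, residue,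
      funext_iff, forall_and]
  have h2 : ∀ a, ((Finset.Ico (g a) (g a + N)).filter fun t : ℤ => (t : ZMod q) = ρ a).card =
      N / q := by
    intro a
    rw [← card_filter_range_cast_eq hq (ρ a - (g a : ZMod q))]
    symm
    refine Finset.card_bij (fun (j : ℕ) _ => g a + (j : ℤ)) ?_ ?_ ?_
    · intro j hj
      simp only [Finset.mem_filter, Finset.mem_range, Finset.mem_Ico] at hj ⊢
      refine ⟨⟨by omega, by omega⟩, ?_⟩
      push_cast
      rw [hj.2]; ring
    · intro i _ j _ h; simpa using h
    · intro t ht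
      simp only [Finset.mem_filter, Finset.mem_Ico] at ht
      refine ⟨(t - g a).toNat, ?_, ?_⟩
      · simp only [Finset.mem_filter, Finset.mem_range]
        refine ⟨by omega, ?_⟩
        have : (((t - g a).toNat : ℤ) : ZMod q) = ((t - g a : ℤ) : ZMod q) := by
          rw [Int.toNat_of_nonneg (by omega)]
        rw [Int.cast_natCast] at this
        rw [this]; push_cast; rw [ht.2]
      · omega
  rw [h1, Fintype.card_piFinset, Finset.prod_congr rfl fun a _ => h2 a]
  simp

/-- The initial points of the `2 * L` intervals of length `n` which fill `[0, 2 * L * n + 1)` up to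
one point in the middle. -/
def slot (n L j : ℕ) : ℕ := j * n + if j < L then 0 else 1

lemma slot_add_le {n L i j : ℕ} (h : i < j) : slot n L i + n ≤ slot n L j := by
  unfold slot
  have : (i + 1) * n ≤ j * n := Nat.mul_le_mul_right _ h
  rw [add_mul, one_mul] at this
  split_ifs <;> omega

lemma slot_add_le_side {n L j : ℕ} (h : j < 2 * L) : slot n L j + n ≤ 2 * L * n + 1 := by
  unfold slot
  have : (j + 1) * n ≤ 2 * L * n := Nat.mul_le_mul_right _ h
  rw [add_mul, one_mul] at this
  split_ifs <;> omega

/-- The initial corner of the slot with index `j`. -/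
def slotPos {d : ℕ} (n L : ℕ) (j : Fin d → Fin (2 * L)) : Fin d → ℤ := fun a => slot n L (j a)

lemma cube_slotPos_subset {d n L : ℕ} (g : Fin d → ℤ) (j : Fin d → Fin (2 * L)) :
    cube (g + slotPos n L j) n ⊆ cube g (2 * L * n + 1) := by
  intro h hh
  rw [mem_cube] at hh ⊢
  intro a
  have h1 := hh a
  have h2 := slot_add_le_side (n := n) (j a).2
  simp only [Pi.add_apply, slotPos] at h1
  omega

/-- The slots are disjoint. -/
lemma eq_of_mem_cube_slotPos {d n L : ℕ} {g h : Fin d → ℤ} {i j : Fin d → Fin (2 * L)}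
    (hi : h ∈ cube (g + slotPos n L i) n) (hj : h ∈ cube (g + slotPos n L j) n) : i = j := by
  rw [mem_cube] at hi hj
  funext a
  have h1 := hi a
  have h2 := hj a
  simp only [Pi.add_apply, slotPos] at h1 h2
  rcases lt_trichotomy (i a) (j a) with h | h | h
  · have := slot_add_le (n := n) (L := L) (Fin.lt_def.1 h); omega
  · exact h
  · have := slot_add_le (n := n) (L := L) (Fin.lt_def.1 h); omega

/-- The slots are equidistributed in the residue classes modulo `q`. -/
lemma card_filter_residue_slotPos {d n L q : ℕ} [NeZero q] (hn : (n : ZMod q) = 1) (hq : q ∣ L)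
    (ρ : Fin d → ZMod q) :
    (Finset.univ.filter fun j : Fin d → Fin (2 * L) => residue q (slotPos n L j) = ρ).card =
      (2 * L / q) ^ d := by
  have h1 : (Finset.univ.filter fun j : Fin d → Fin (2 * L) => residue q (slotPos n L j) = ρ) =
      Fintype.piFinset fun a =>
        Finset.univ.filter fun t : Fin (2 * L) => (slot n L t : ZMod q) = ρ a := by
    ext h
    simp [residue, slotPos, funext_iff]
  have h2 : ∀ r : ZMod q, (Finset.univ.filter fun t : Fin (2 * L) =>
      (slot n L t : ZMod q) = r).card = 2 * L / q := by
    intro r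
    rw [Finset.card_filter, Fin.sum_univ_eq_sum_range
      (fun t => if (slot n L t : ZMod q) = r then (1 : ℕ) else 0), two_mul, Finset.sum_range_add,
      Nat.add_div_of_dvd_right hq]
    congr 1
    · rw [← card_filter_range_cast_eq hq r, Finset.card_filter]
      refine Finset.sum_congr rfl fun j hj => ?_
      have : slot n L j = j * n := by simp [slot, Finset.mem_range.1 hj]
      rw [this, Nat.cast_mul, hn, mul_one]
    · rw [← card_filter_range_cast_eq hq (r - 1), Finset.card_filter]
      refine Finset.sum_congr rfl fun j hj => ?_
      have : slot n L (L + j) = (L + j) * n + 1 := by simp [slot]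
      have hL : (L : ZMod q) = 0 := (ZMod.natCast_eq_zero_iff L q).2 hq
      simp only [this, Nat.cast_add, Nat.cast_mul, hn, mul_one, hL, zero_add, Nat.cast_one,
        eq_sub_iff_add_eq]
  rw [h1, Fintype.card_piFinset, Finset.prod_congr rfl fun a _ => h2 (ρ a)]
  simp

/-- Configurations prescribed in the slots of a cube, and outside them, can be glued. -/
lemma exists_glue {d n L : ℕ} {A : Type*} (g : Fin d → ℤ)
    (y : (Fin d → Fin (2 * L)) → (Fin d → ℤ) → A) (z : (Fin d → ℤ) → A) :
    ∃ x : (Fin d → ℤ) → A, (∀ j, ∀ h ∈ cube (g + slotPos n L j) n, x h = y j h) ∧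
      ∀ h, (∀ j, h ∉ cube (g + slotPos n L j) n) → x h = z h := by
  classical
  refine ⟨fun h => if hh : ∃ j, h ∈ cube (g + slotPos n L j) n then y hh.choose h else z h,
    fun j h hj => ?_, fun h hh => ?_⟩
  · have hex : ∃ j, h ∈ cube (g + slotPos n L j) n := ⟨j, hj⟩
    simp only [dif_pos hex]
    rw [eq_of_mem_cube_slotPos hex.choose_spec hj]
  · exact dif_neg (by push Not; exact hh)

/-! ### Patterns -/

/-- The pattern of `x` on the cube `g + [0, n)^d`. -/
def pattern {d : ℕ} {A : Type*} (n : ℕ) (x : (Fin d → ℤ) → A) (g : Fin d → ℤ) :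
    (Fin d → Fin n) → A := fun i => x (g + fun a => ((i a : ℕ) : ℤ))

lemma pattern_eq_iff {d : ℕ} {A : Type*} {n : ℕ} {x y : (Fin d → ℤ) → A} {g g' : Fin d → ℤ} :
    pattern n x g = pattern n y g' ↔ ∀ i ∈ cube (0 : Fin d → ℤ) n, x (g + i) = y (g' + i) := by
  constructor
  · intro h i hi
    rw [mem_cube] at hi
    simp only [Pi.zero_apply, zero_add] at hi
    have := congrFun h fun a => ⟨(i a).toNat, by have := hi a; omega⟩
    have hi' : (fun a => (((i a).toNat : ℕ) : ℤ)) = i := by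
      funext a; exact Int.toNat_of_nonneg (hi a).1
    simp only [pattern, hi'] at this
    exact this
  · intro h
    funext i
    refine h _ (mem_cube.2 fun a => ?_)
    simp

lemma pattern_congr {d : ℕ} {A : Type*} {n : ℕ} {x y : (Fin d → ℤ) → A} {g : Fin d → ℤ}
    (h : ∀ i ∈ cube g n, x i = y i) : pattern n x g = pattern n y g :=
  pattern_eq_iff.2 fun i hi => h _ (by simpa using (add_mem_cube (g := g)).2 hi)

lemma pattern_shift {d : ℕ} {A : Type*} (n : ℕ) (x : (Fin d → ℤ) → A) (g h : Fin d → ℤ) :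
    pattern n (fun i => x (h + i)) g = pattern n x (h + g) := by
  funext i; simp [pattern, add_assoc]

lemma exists_pattern_eq {d : ℕ} {A : Type*} [Nonempty A] {n : ℕ} (w : (Fin d → Fin n) → A)
    (g : Fin d → ℤ) : ∃ x : (Fin d → ℤ) → A, pattern n x g = w := by
  classical
  let emb : (Fin d → Fin n) → (Fin d → ℤ) := fun i => g + fun a => ((i a : ℕ) : ℤ)
  have hinj : Function.Injective emb := by
    intro i j h
    funext a
    have := congrFun h a
    simp only [emb, Pi.add_apply, add_right_inj, Nat.cast_inj] at this
    exact Fin.ext this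
  exact ⟨Function.extend emb w fun _ => Classical.arbitrary A,
    funext fun i => hinj.extend_apply w _ i⟩

/-! ### The hierarchy of blocks -/

/-- A set of patterns ("blocks") on a cube with a given side length. -/
structure Stage (d : ℕ) (A : Type*) where
  /-- The side length of the blocks. -/
  side : ℕ
  /-- The allowed blocks. -/
  blocks : Finset ((Fin d → Fin side) → A)

/-- The configuration `x` has a block at the position `g`. -/
def Stage.IsBlock {d : ℕ} {A : Type*} (S : Stage d A) (x : (Fin d → ℤ) → A) (g : Fin d → ℤ) :
    Prop := pattern S.side x g ∈ S.blocks

lemma Stage.IsBlock.congr {d : ℕ} {A : Type*} {S : Stage d A} {x y : (Fin d → ℤ) → A}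
    {g : Fin d → ℤ} (hx : S.IsBlock x g) (h : ∀ i ∈ cube g S.side, y i = x i) : S.IsBlock y g := by
  unfold Stage.IsBlock at *
  rwa [pattern_congr h]

lemma Stage.isBlock_shift {d : ℕ} {A : Type*} {S : Stage d A} {x : (Fin d → ℤ) → A}
    {g h : Fin d → ℤ} : S.IsBlock (fun i => x (h + i)) g ↔ S.IsBlock x (h + g) := by
  unfold Stage.IsBlock
  rw [pattern_shift]

/-- The number of slots, among those of the next stage, with a given residue modulo `q`. -/
def classSize (d L q : ℕ) : ℕ := (2 * L / q) ^ d

open Classical in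
/-- The next stage: its blocks are the patterns on a cube of side length `2 * L * S.side + 1` which
have blocks of `S` in all slots, such that the arrangement of these blocks is balanced
with respect to the residues of the slots modulo `q`. The symbols outside the slots are
arbitrary. -/
def Stage.next {d : ℕ} {A : Type*} [Fintype A] (S : Stage d A) (L q : ℕ) (ε : ℝ) : Stage d A where
  side := 2 * L * S.side + 1
  blocks := Finset.univ.filter fun w => ∃ x : (Fin d → ℤ) → A, pattern _ x 0 = w ∧
    (∀ j, S.IsBlock x (slotPos S.side L j)) ∧
      IsBalanced (fun j => residue q (slotPos S.side L j)) S.blocks (classSize d L q) ε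
        fun j => pattern S.side x (slotPos S.side L j)

lemma Stage.isBlock_next {d : ℕ} {A : Type*} [Fintype A] {S : Stage d A} {L q : ℕ} {ε : ℝ}
    {x : (Fin d → ℤ) → A} {g : Fin d → ℤ} :
    (S.next L q ε).IsBlock x g ↔ (∀ j, S.IsBlock x (g + slotPos S.side L j)) ∧
      IsBalanced (fun j => residue q (slotPos S.side L j)) S.blocks (classSize d L q) ε
        fun j => pattern S.side x (g + slotPos S.side L j) := by
  have h0 : (S.next L q ε).IsBlock x g ↔ ∃ x' : (Fin d → ℤ) → A,
      pattern (2 * L * S.side + 1) x' 0 = pattern (2 * L * S.side + 1) x g ∧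
      (∀ j, S.IsBlock x' (slotPos S.side L j)) ∧
      IsBalanced (fun j => residue q (slotPos S.side L j)) S.blocks (classSize d L q) ε
        fun j => pattern S.side x' (slotPos S.side L j) := by
    classical
    exact Finset.mem_filter.trans (and_iff_right (Finset.mem_univ _))
  rw [h0]
  constructor
  · rintro ⟨x', hx', h⟩
    have hpat : ∀ j, pattern S.side x' (slotPos S.side L j) =
        pattern S.side x (g + slotPos S.side L j) := by
      intro j
      rw [pattern_eq_iff] at hx' ⊢
      intro i hi
      have := hx' (slotPos S.side L j + i) (cube_slotPos_subset 0 j (by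
        rw [zero_add]; simpa using (add_mem_cube (g := slotPos S.side L j)).2 hi))
      rw [zero_add] at this
      rw [this, add_assoc]
    simpa only [Stage.IsBlock, hpat] using h
  · intro h
    refine ⟨fun i => x (g + i), ?_, ?_⟩
    · rw [pattern_shift, add_zero]
    · simpa only [Stage.IsBlock, pattern_shift] using h

open Classical in
/-- The set `P` meets large cubes in a small proportion of their points, uniformly in the position
of the cube. -/
def IsSparse {d : ℕ} (P : Set (Fin d → ℤ)) : Prop :=
  ∀ δ : ℝ, 0 < δ → ∃ N : ℕ, ∀ n ≥ N, ∀ g, (((cube g n).filter (· ∈ P)).card : ℝ) ≤ δ * (n : ℝ) ^ d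

/-- The relative error allowed for the frequencies of the blocks of stage `k`. -/
def tolerance (k : ℕ) : ℝ := 1 / ((k : ℝ) + 2)

lemma tolerance_pos (k : ℕ) : 0 < tolerance k := by unfold tolerance; positivity

open Classical in
/-- The conditions on `L` under which stage `k + 1` is formed from the stage `k` given by `S`.
By `classes_large` at least half of all arrangements of blocks are balanced up to half the
tolerance; by `sparse` the other half of the tolerance suffices for changing the blocks in all slots
which meet `P`, and in one more slot. -/
structure Admissible {d : ℕ} {A : Type*} (P : Set (Fin d → ℤ)) (S : Stage d A) (k L : ℕ) :
    Prop where
  two_le : 2 ≤ L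
  dvd : (k + 1).factorial ∣ L
  side_large : (k + 1) * (k + 1).factorial ^ d ≤ 2 * L * S.side + 1
  classes_large : 2 * ((k.factorial ^ d : ℕ) : ℝ) * (S.blocks.card : ℝ) ^ 3 ≤
    (tolerance k / 2) ^ 2 * classSize d L k.factorial
  sparse : ∀ g, (S.blocks.card : ℝ) *
    ((((cube g (2 * L * S.side + 1)).filter (· ∈ P)).card : ℝ) + 1) ≤
      tolerance k / 2 * classSize d L k.factorial

/-- The properties of stage `k` which are preserved in the construction. Blocks have sides prime to
`k!`, and therefore their positions in a block of the next stage are equidistributed modulo `k!`. -/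
structure Stage.IsValid {d : ℕ} {A : Type*} (S : Stage d A) (k : ℕ) : Prop where
  side_pos : 0 < S.side
  cast_side : (S.side : ZMod k.factorial) = 1
  nonempty : S.blocks.Nonempty
  side_large : k * k.factorial ^ d ≤ S.side

lemma exists_admissible {d : ℕ} {A : Type*} (hd : 1 ≤ d) {P : Set (Fin d → ℤ)} (hP : IsSparse P)
    {S : Stage d A} {k : ℕ} (hS : S.IsValid k) : ∃ L, Admissible P S k L := by
  set q : ℝ := (k.factorial : ℝ) with hq
  set V : ℝ := (S.blocks.card : ℝ) with hV
  set ε : ℝ := tolerance k with hε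
  set n : ℝ := (S.side : ℝ) with hn
  have hqpos : 0 < q := by rw [hq]; exact_mod_cast k.factorial_pos
  have hVpos : 0 < V := by rw [hV]; exact_mod_cast hS.nonempty.card_pos
  have hεpos : 0 < ε := tolerance_pos k
  have hnpos : 1 ≤ n := by rw [hn]; exact_mod_cast hS.side_pos
  obtain ⟨N, hN⟩ := hP (ε / (4 * V * q ^ d * (2 * n) ^ d)) (by positivity)
  obtain ⟨B, hB⟩ := exists_nat_ge (4 * V * q ^ d / ε + 8 * q ^ d * q ^ d * V ^ 3 / ε ^ 2)
  set t : ℕ := 2 + N + B + (k + 1) * (k + 1).factorial ^ d with ht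
  have hfac : 1 ≤ (k + 1).factorial := (k + 1).factorial_pos
  set L : ℕ := (k + 1).factorial * t with hL
  have htL : t ≤ L := Nat.le_mul_of_pos_left _ hfac
  have hkL : k.factorial ∣ 2 * L :=
    (((Nat.factorial_dvd_factorial k.le_succ).mul_right t)).mul_left 2
  have hLn : 2 * L + 1 ≤ 2 * L * S.side + 1 := by
    have := Nat.le_mul_of_pos_right (2 * L) hS.side_pos
    omega
  set K : ℝ := 2 * (L : ℝ) with hK
  have hK1 : 1 ≤ K := by
    have : (1 : ℝ) ≤ L := by exact_mod_cast (show 1 ≤ L by omega)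
    linarith
  have hM : (classSize d L k.factorial : ℝ) = K ^ d / q ^ d := by
    rw [classSize, Nat.cast_pow, Nat.cast_div hkL (by exact_mod_cast k.factorial_ne_zero)]
    rw [div_pow]; push_cast; rfl
  have hKd : K ≤ K ^ d := le_self_pow₀ hK1 (by omega)
  have hBK : (B : ℝ) ≤ K := by
    have : (B : ℝ) ≤ L := by exact_mod_cast (show B ≤ L by omega)
    linarith
  have hp1 : 0 < 4 * V * q ^ d / ε := by positivity
  have hp2 : 0 < 8 * q ^ d * q ^ d * V ^ 3 / ε ^ 2 := by positivity
  have hVK : V ≤ ε / 4 * (K ^ d / q ^ d) := by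
    have h : 4 * V * q ^ d / ε ≤ K ^ d := by linarith
    rw [div_le_iff₀ hεpos] at h
    rw [← mul_div_assoc, le_div_iff₀ (by positivity)]
    linarith
  refine ⟨L, by omega, Dvd.intro _ rfl, by omega, ?_, fun g => ?_⟩
  · rw [hM, Nat.cast_pow, ← hq, ← hV]
    have h : 8 * q ^ d * q ^ d * V ^ 3 / ε ^ 2 ≤ K ^ d := by linarith
    rw [div_le_iff₀ (by positivity)] at h
    rw [← mul_div_assoc, le_div_iff₀ (by positivity)]
    nlinarith
  · rw [hM]
    have h1 := hN (2 * L * S.side + 1) (by omega) g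
    have h2 : (((2 * L * S.side + 1 : ℕ) : ℝ)) ≤ K * (2 * n) := by
      push_cast
      rw [← hn, ← hK]
      nlinarith
    have h3 : (((2 * L * S.side + 1 : ℕ) : ℝ)) ^ d ≤ (K * (2 * n)) ^ d :=
      pow_le_pow_left₀ (Nat.cast_nonneg _) h2 d
    have h4 := h1.trans (mul_le_mul_of_nonneg_left h3 (by positivity))
    have h5 : V * (ε / (4 * V * q ^ d * (2 * n) ^ d) * (K * (2 * n)) ^ d) =
        ε / 4 * (K ^ d / q ^ d) := by
      rw [mul_pow K]
      field_simp
    have h6 := mul_le_mul_of_nonneg_left h4 hVpos.le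
    rw [h5] at h6
    rw [mul_add]
    linarith

lemma Admissible.classSize_pos {d : ℕ} {A : Type*} {P : Set (Fin d → ℤ)} {S : Stage d A}
    {k L : ℕ} (h : Admissible P S k L) : 0 < classSize d L k.factorial := by
  have h2 := h.two_le
  have h1 := Nat.le_of_dvd (by omega) ((Nat.factorial_dvd_factorial k.le_succ).trans h.dvd)
  exact pow_pos (Nat.div_pos (by omega) k.factorial_pos) d

/-- At least half of all arrangements of blocks in the slots are balanced. -/
lemma Admissible.card_arrangements_le {d : ℕ} {A : Type*} {P : Set (Fin d → ℤ)}
    {S : Stage d A} {k L : ℕ} (hS : S.IsValid k) (h : Admissible P S k L) {ε : ℝ}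
    (hε : tolerance k / 2 ≤ ε) [DecidablePred fun u : (Fin d → Fin (2 * L)) → S.blocks =>
      IsBalanced (fun j => residue k.factorial (slotPos S.side L j)) S.blocks
        (classSize d L k.factorial) ε fun j => (u j : (Fin d → Fin S.side) → A)] :
    S.blocks.card ^ (2 * L) ^ d ≤
      2 * (Finset.univ.filter fun u : (Fin d → Fin (2 * L)) → S.blocks =>
        IsBalanced (fun j => residue k.factorial (slotPos S.side L j)) S.blocks
          (classSize d L k.factorial) ε fun j => (u j : (Fin d → Fin S.side) → A)).card := by
  have : NeZero k.factorial := ⟨k.factorial_ne_zero⟩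
  have hε0 := tolerance_pos k
  have hdvd : k.factorial ∣ L := (Nat.factorial_dvd_factorial k.le_succ).trans h.dvd
  have hM := h.classSize_pos
  have := card_le_two_mul_card_isBalanced
    (fun j : Fin d → Fin (2 * L) => residue k.factorial (slotPos S.side L j)) S.blocks
    (M := classSize d L k.factorial) (ε := ε)
    (fun ρ => by
      rw [classSize, ← card_filter_residue_slotPos hS.cast_side hdvd ρ]
      congr!)
    (by linarith) hM hS.nonempty (by
      have hl := h.classes_large
      have hc : Fintype.card (Fin d → ZMod k.factorial) = k.factorial ^ d := by
        simp [ZMod.card]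
      rw [hc]
      refine hl.trans (mul_le_mul_of_nonneg_right ?_ (Nat.cast_nonneg _))
      exact pow_le_pow_left₀ (by positivity) hε 2)
  have hJ : Fintype.card (Fin d → Fin (2 * L)) = (2 * L) ^ d := by simp
  rw [hJ] at this
  convert this

/-- The lower bound for the number of blocks which yields the entropy. -/
lemma Admissible.card_blocks_le {d : ℕ} {A : Type*} [Fintype A] [Nonempty A]
    {P : Set (Fin d → ℤ)} {S : Stage d A} {k L : ℕ} (hS : S.IsValid k) (h : Admissible P S k L) :
    S.blocks.card ^ (2 * L) ^ d ≤ 2 * (S.next L k.factorial (tolerance k)).blocks.card := by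
  classical
  refine (h.card_arrangements_le hS (half_le_self (tolerance_pos k).le)).trans
    (Nat.mul_le_mul_left 2 ?_)
  choose v hv using fun (w : S.blocks) (g : Fin d → ℤ) => exists_pattern_eq w.1 g
  have z : (Fin d → ℤ) → A := fun _ => Classical.arbitrary A
  choose x hx _ using fun u : (Fin d → Fin (2 * L)) → S.blocks =>
    exists_glue (n := S.side) (L := L) 0
      (fun j => v (u j) (0 + slotPos S.side L j)) z
  have hpat : ∀ u j, pattern S.side (x u) (0 + slotPos S.side L j) = u j := fun u j => by
    rw [pattern_congr (hx u j), hv]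
  refine Finset.card_le_card_of_injOn (fun u => pattern (2 * L * S.side + 1) (x u) 0) ?_ ?_
  · intro u hu
    have hu := (Finset.mem_filter.1 (Finset.mem_coe.1 hu)).2
    refine Finset.mem_coe.2 ?_
    change (S.next L k.factorial (tolerance k)).IsBlock (x u) 0
    rw [Stage.isBlock_next]
    simp only [Stage.IsBlock, hpat]
    exact ⟨fun j => (u j).2, hu⟩
  · intro u _ u' _ huu
    funext j
    refine Subtype.ext ?_
    rw [← hpat u j, ← hpat u' j]
    have huu' := pattern_eq_iff.1 huu
    refine pattern_eq_iff.2 fun i hi => ?_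
    have := huu' (slotPos S.side L j + i) (cube_slotPos_subset 0 j (by
      rw [zero_add]; simpa using (add_mem_cube (g := slotPos S.side L j)).2 hi))
    simpa using this

/-- Blocks of `S` can be found with prescribed symbols on `P`. -/
def Stage.Interpolates {d : ℕ} {A : Type*} (S : Stage d A) (P : Set (Fin d → ℤ)) : Prop :=
  ∀ (g : Fin d → ℤ) (z : (Fin d → ℤ) → A),
    ∃ x, S.IsBlock x g ∧ ∀ h ∈ cube g S.side, h ∈ P → x h = z h

/-- A block of stage `k`, put into any slot, extends to a block of stage `k + 1` with prescribed
symbols on the rest of `P`: since `P` meets few slots, the blocks in these slots may be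
chosen at will without spoiling the frequencies. -/
lemma Admissible.exists_extension {d : ℕ} {A : Type*} [Fintype A] [Nonempty A]
    {P : Set (Fin d → ℤ)} {S : Stage d A} {k L : ℕ} (hS : S.IsValid k) (h : Admissible P S k L)
    (hI : S.Interpolates P) (g : Fin d → ℤ) (z : (Fin d → ℤ) → A) (j₀ : Fin d → Fin (2 * L))
    {y : (Fin d → ℤ) → A} (hy : S.IsBlock y (g + slotPos S.side L j₀)) :
    ∃ x, (S.next L k.factorial (tolerance k)).IsBlock x g ∧
      (∀ h ∈ cube (g + slotPos S.side L j₀) S.side, x h = y h) ∧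
      ∀ h ∈ cube g (S.next L k.factorial (tolerance k)).side, h ∈ P →
        h ∉ cube (g + slotPos S.side L j₀) S.side → x h = z h := by
  classical
  obtain ⟨u, hu⟩ : ∃ u : (Fin d → Fin (2 * L)) → S.blocks,
      IsBalanced (fun j => residue k.factorial (slotPos S.side L j)) S.blocks
        (classSize d L k.factorial) (tolerance k / 2)
        fun j => (u j : (Fin d → Fin S.side) → A) := by
    have h1 := h.card_arrangements_le hS (le_refl (tolerance k / 2))
    have h2 : 0 < S.blocks.card ^ (2 * L) ^ d := pow_pos hS.nonempty.card_pos _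
    obtain ⟨u, hu⟩ := Finset.card_pos.1 (by omega : 0 < Finset.card (Finset.univ.filter
      fun u : (Fin d → Fin (2 * L)) → S.blocks =>
        IsBalanced (fun j => residue k.factorial (slotPos S.side L j)) S.blocks
          (classSize d L k.factorial) (tolerance k / 2)
          fun j => (u j : (Fin d → Fin S.side) → A)))
    exact ⟨u, (Finset.mem_filter.1 hu).2⟩
  choose v hv using fun j => exists_pattern_eq (u j).1 (g + slotPos S.side L j)
  choose p hp hpz using fun j => hI (g + slotPos S.side L j) z
  -- the slots which meet `P`
  let D : Finset (Fin d → Fin (2 * L)) :=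
    Finset.univ.filter fun j => ∃ h ∈ cube (g + slotPos S.side L j) S.side, h ∈ P
  have hD : D.card ≤ ((cube g (2 * L * S.side + 1)).filter (· ∈ P)).card := by
    have hex : ∀ j ∈ D, ∃ h, h ∈ cube (g + slotPos S.side L j) S.side ∧ h ∈ P := by
      intro j hj
      obtain ⟨h, h1, h2⟩ := (Finset.mem_filter.1 hj).2
      exact ⟨h, h1, h2⟩
    choose! f hf hfP using hex
    refine Finset.card_le_card_of_injOn f ?_ ?_
    · intro j hj
      exact Finset.mem_coe.2 (Finset.mem_filter.2 ⟨cube_slotPos_subset g j (hf j hj), hfP j hj⟩)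
    · intro i hi j hj hij
      exact eq_of_mem_cube_slotPos (hf i hi) (hij ▸ hf j hj)
  obtain ⟨x, hx, hxz⟩ := exists_glue (n := S.side) (L := L) g
    (fun j => if j = j₀ then y else if j ∈ D then p j else v j) z
  have hpat : ∀ j, pattern S.side x (g + slotPos S.side L j) = pattern S.side
      (if j = j₀ then y else if j ∈ D then p j else v j) (g + slotPos S.side L j) :=
    fun j => pattern_congr (hx j)
  refine ⟨x, Stage.isBlock_next.2 ⟨fun j => ?_, ?_⟩, fun h hh => ?_, fun h hh hP hnot => ?_⟩
  · unfold Stage.IsBlock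
    rw [hpat]
    split_ifs with h1 h2
    · subst h1; exact hy
    · exact hp j
    · rw [hv]; exact (u j).2
  · have hcard : (S.blocks.card : ℝ) * ((insert j₀ D).card : ℝ) ≤
        tolerance k / 2 * classSize d L k.factorial := by
      refine le_trans (mul_le_mul_of_nonneg_left ?_ (Nat.cast_nonneg _)) (h.sparse g)
      exact_mod_cast (Finset.card_insert_le _ _).trans (Nat.add_le_add_right hD 1)
    have := hu.of_eqOn (u' := fun j => pattern S.side x (g + slotPos S.side L j)) (insert j₀ D)
      (fun j hj => by
        rw [Finset.mem_insert, not_or] at hj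
        rw [hpat, if_neg hj.1, if_neg hj.2, hv]) hcard
    rwa [add_halves] at this
  · rw [hx j₀ h hh, if_pos rfl]
  · by_cases hj : ∃ j, h ∈ cube (g + slotPos S.side L j) S.side
    · obtain ⟨j, hj⟩ := hj
      have hjj : j ≠ j₀ := by rintro rfl; exact hnot hj
      have hjD : j ∈ D := Finset.mem_filter.2 ⟨Finset.mem_univ _, h, hj, hP⟩
      rw [hx j h hj, if_neg hjj, if_pos hjD]
      exact hpz j h hj hP
    · push Not at hj
      exact hxz h hj

open Classical in
/-- The number `L` used to form stage `k + 1` from the stage `k` given by `S`: half the number of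
slots in each coordinate. The value `0` does not occur for valid stages and sparse `P`. -/
def scale {d : ℕ} {A : Type*} (P : Set (Fin d → ℤ)) (S : Stage d A) (k : ℕ) : ℕ :=
  if h : ∃ L, Admissible P S k L then h.choose else 0

/-- The hierarchy of blocks. The blocks of stage `0` are all single symbols. -/
def stage {d : ℕ} (A : Type*) [Fintype A] (P : Set (Fin d → ℤ)) : ℕ → Stage d A
  | 0 => { side := 1, blocks := by classical exact Finset.univ }
  | k + 1 => (stage A P k).next (scale P (stage A P k) k) k.factorial (tolerance k)

section
variable {d : ℕ} {A : Type*} [Fintype A] [Nonempty A] {P : Set (Fin d → ℤ)}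

lemma stage_isValid_and_interpolates (hd : 1 ≤ d) (hP : IsSparse P) (k : ℕ) :
    (stage A P k).IsValid k ∧ (stage A P k).Interpolates P := by
  classical
  induction k with
  | zero =>
    refine ⟨⟨one_pos, Nat.cast_one, ?_, by simp⟩, fun g z => ⟨z, ?_, fun _ _ _ => rfl⟩⟩
    · simp [stage, Finset.univ_nonempty]
    · exact Finset.mem_univ _
  | succ k ih =>
    obtain ⟨hS, hI⟩ := ih
    have hex := exists_admissible hd hP hS
    have hL : Admissible P (stage A P k) k (scale P (stage A P k) k) := by
      unfold scale; rw [dif_pos hex]; exact hex.choose_spec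
    have hI' : (stage A P (k + 1)).Interpolates P := by
      intro g z
      have h2 := hL.two_le
      have j₀ : Fin d → Fin (2 * scale P (stage A P k) k) := fun _ => ⟨0, by omega⟩
      obtain ⟨y, hy, hyz⟩ := hI (g + slotPos (stage A P k).side _ j₀) z
      obtain ⟨x, hx, hxy, hxz⟩ := hL.exists_extension hS hI g z j₀ hy
      refine ⟨x, hx, fun h hh hhP => ?_⟩
      by_cases hm : h ∈ cube (g + slotPos (stage A P k).side _ j₀) (stage A P k).side
      · rw [hxy h hm, hyz h hm hhP]
      · exact hxz h hh hhP hm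
    refine ⟨⟨Nat.succ_pos _, ?_, ?_, hL.side_large⟩, hI'⟩
    · change ((2 * scale P (stage A P k) k * (stage A P k).side + 1 : ℕ) :
        ZMod (k + 1).factorial) = 1
      have := (ZMod.natCast_eq_zero_iff _ _).2 hL.dvd
      push_cast
      rw [this]; ring
    · obtain ⟨x, hx, -⟩ := hI' 0 fun _ => Classical.arbitrary A
      exact ⟨_, hx⟩

lemma stage_isValid (hd : 1 ≤ d) (hP : IsSparse P) (k : ℕ) : (stage A P k).IsValid k :=
  (stage_isValid_and_interpolates hd hP k).1

lemma stage_interpolates (hd : 1 ≤ d) (hP : IsSparse P) (k : ℕ) :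
    (stage A P k).Interpolates P :=
  (stage_isValid_and_interpolates hd hP k).2

lemma admissible_scale (hd : 1 ≤ d) (hP : IsSparse P) (k : ℕ) :
    Admissible P (stage A P k) k (scale P (stage A P k) k) := by
  have hex := exists_admissible hd hP (stage_isValid (A := A) hd hP k)
  unfold scale; rw [dif_pos hex]; exact hex.choose_spec

end

/-! ### The subshift of the hierarchy -/

/-- The window `[-N, N]^d`. -/
def window (d N : ℕ) : Finset (Fin d → ℤ) := cube (fun _ => -(N : ℤ)) (2 * N + 1)

lemma mem_window {d N : ℕ} {h : Fin d → ℤ} :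
    h ∈ window d N ↔ ∀ a, -(N : ℤ) ≤ h a ∧ h a ≤ N := by
  rw [window, mem_cube]
  refine forall_congr' fun a => ?_
  push_cast
  constructor <;> intro h <;> omega

lemma exists_subset_window {d : ℕ} (s : Finset (Fin d → ℤ)) : ∃ N, s ⊆ window d N := by
  refine ⟨∑ h ∈ s, ∑ a, (h a).natAbs, fun h hh => mem_window.2 fun a => ?_⟩
  have h1 : (h a).natAbs ≤ ∑ a, (h a).natAbs :=
    Finset.single_le_sum (f := fun a => (h a).natAbs) (fun _ _ => Nat.zero_le _)
      (Finset.mem_univ a)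
  have h2 : ∑ a, (h a).natAbs ≤ ∑ h ∈ s, ∑ a, (h a).natAbs :=
    Finset.single_le_sum (f := fun h : Fin d → ℤ => ∑ a, (h a).natAbs)
      (fun _ _ => Nat.zero_le _) hh
  omega

lemma setOf_eqOn_window_mem_nhds {d : ℕ} {A : Type*} [TopologicalSpace A] [DiscreteTopology A]
    (x : (Fin d → ℤ) → A) (N : ℕ) : {y | ∀ h ∈ window d N, y h = x h} ∈ 𝓝 x := by
  have : {y : (Fin d → ℤ) → A | ∀ h ∈ window d N, y h = x h} =
      ((window d N : Finset (Fin d → ℤ)) : Set (Fin d → ℤ)).pi fun h => {x h} := by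
    ext y; simp [Set.mem_pi]
  rw [this]
  exact set_pi_mem_nhds (Finset.finite_toSet _) fun h _ => by simp

lemma exists_window_subset_of_mem_nhds {d : ℕ} {A : Type*} [TopologicalSpace A]
    {x : (Fin d → ℤ) → A} {U : Set ((Fin d → ℤ) → A)} (hU : U ∈ 𝓝 x) :
    ∃ N, ∀ y : (Fin d → ℤ) → A, (∀ h ∈ window d N, y h = x h) → y ∈ U := by
  rw [nhds_pi, Filter.mem_pi] at hU
  obtain ⟨I, hI, t, ht, hsub⟩ := hU
  obtain ⟨N, hN⟩ := exists_subset_window hI.toFinset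
  refine ⟨N, fun y hy => hsub fun i hi => ?_⟩
  rw [hy i (hN (hI.mem_toFinset.2 hi))]
  exact mem_of_mem_nhds (ht i)

/-- The subshift of all configurations whose patterns on windows occur inside blocks of the
hierarchy. The stage `k` is not prescribed, but it is large for large windows, as the window
is contained in the cube of the block. -/
def hierarchySubshift {d : ℕ} (A : Type*) [Fintype A] [TopologicalSpace A] [DiscreteTopology A]
    (P : Set (Fin d → ℤ)) : Subshift A (Fin d → ℤ) where
  carrier := {x | ∀ N : ℕ, ∃ k g, ∃ y : (Fin d → ℤ) → A, (stage A P k).IsBlock y g ∧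
    window d N ⊆ cube g (stage A P k).side ∧ ∀ h ∈ window d N, y h = x h}
  isClosed := by
    refine isClosed_of_closure_subset fun x hx N => ?_
    obtain ⟨x', hx', hX⟩ := mem_closure_iff_nhds.1 hx _ (setOf_eqOn_window_mem_nhds x N)
    obtain ⟨k, g, y, h1, h2, h3⟩ := hX N
    exact ⟨k, g, y, h1, h2, fun h hh => (h3 h hh).trans (hx' h hh)⟩
  mapsTo := by
    intro v x hx N
    obtain ⟨M, hM⟩ := exists_subset_window ((window d N).image fun h => v + h)
    have hM' : ∀ h ∈ window d N, v + h ∈ window d M := fun h hh =>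
      hM (Finset.mem_image_of_mem _ hh)
    obtain ⟨k, g, y, h1, h2, h3⟩ := hx M
    refine ⟨k, g - v, fun i => y (v + i), ?_, fun h hh => ?_, fun h hh => h3 _ (hM' h hh)⟩
    · rw [Stage.isBlock_shift, add_sub_cancel]; exact h1
    · have := h2 (hM' h hh)
      rw [← add_sub_cancel v g] at this
      exact add_mem_cube.1 this

section
variable {d : ℕ} {A : Type*} [Fintype A] [Nonempty A] {P : Set (Fin d → ℤ)}

/-- A block of the hierarchy with prescribed symbols on the rest of `P` extends to one of the next
stage, the cube of which is larger on all sides. -/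
lemma exists_next_block (hd : 1 ≤ d) (hP : IsSparse P) (z : (Fin d → ℤ) → A) {k : ℕ}
    {g : Fin d → ℤ} {y : (Fin d → ℤ) → A} (hy : (stage A P k).IsBlock y g) :
    ∃ (g' : Fin d → ℤ) (y' : (Fin d → ℤ) → A), (stage A P (k + 1)).IsBlock y' g' ∧
      (∀ a, g' a + 1 ≤ g a ∧
        g a + (stage A P k).side + 1 ≤ g' a + (stage A P (k + 1)).side) ∧
      (∀ h ∈ cube g (stage A P k).side, y' h = y h) ∧
      ∀ h ∈ cube g' (stage A P (k + 1)).side, h ∈ P → h ∉ cube g (stage A P k).side →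
        y' h = z h := by
  have hS := stage_isValid (A := A) hd hP k
  have hL := admissible_scale (A := A) hd hP k
  set L := scale P (stage A P k) k with hLdef
  have h2 := hL.two_le
  -- the slot with index `1` in all coordinates has distance at least one from the boundary
  set j₀ : Fin d → Fin (2 * L) := fun _ => ⟨1, by omega⟩ with hj₀
  have hpos : ∀ a, slotPos (stage A P k).side L j₀ a = (stage A P k).side := by
    intro a
    have : 1 < L := by omega
    simp [slotPos, slot, hj₀, this]
  set g' := g - slotPos (stage A P k).side L j₀ with hg'
  have hgg : g' + slotPos (stage A P k).side L j₀ = g := sub_add_cancel _ _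
  obtain ⟨x, hx, hxy, hxz⟩ := hL.exists_extension hS (stage_interpolates hd hP k) g' z j₀
    (y := y) (by rwa [hgg])
  rw [hgg] at hxy hxz
  refine ⟨g', x, hx, fun a => ?_, hxy, hxz⟩
  have h3 : (stage A P (k + 1)).side = 2 * L * (stage A P k).side + 1 := rfl
  have h4 : 4 * (stage A P k).side ≤ 2 * L * (stage A P k).side :=
    Nat.mul_le_mul_right _ (by omega)
  have h5 : g' a = g a - (stage A P k).side := by rw [hg', Pi.sub_apply, hpos]
  have := hS.side_pos
  omega

variable [TopologicalSpace A] [DiscreteTopology A]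

/-- Every block extends to a point of the subshift with prescribed symbols on the rest of `P`. -/
lemma exists_mem_of_isBlock (hd : 1 ≤ d) (hP : IsSparse P) {k : ℕ} {g : Fin d → ℤ}
    {y : (Fin d → ℤ) → A} (hy : (stage A P k).IsBlock y g) (z : (Fin d → ℤ) → A) :
    ∃ x ∈ (hierarchySubshift A P).carrier, (∀ h ∈ cube g (stage A P k).side, x h = y h) ∧
      ∀ h ∈ P, h ∉ cube g (stage A P k).side → x h = z h := by
  classical
  -- a sequence of blocks on growing cubes which exhaust the lattice
  let T : ℕ → Type _ := fun m =>
    {p : (Fin d → ℤ) × ((Fin d → ℤ) → A) // (stage A P (k + m)).IsBlock p.2 p.1}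
  have step : ∀ m (p : T m), ∃ p' : T (m + 1),
      (∀ a, p'.1.1 a + 1 ≤ p.1.1 a ∧ p.1.1 a + (stage A P (k + m)).side + 1 ≤
        p'.1.1 a + (stage A P (k + (m + 1))).side) ∧
      (∀ h ∈ cube p.1.1 (stage A P (k + m)).side, p'.1.2 h = p.1.2 h) ∧
      ∀ h ∈ cube p'.1.1 (stage A P (k + (m + 1))).side, h ∈ P →
        h ∉ cube p.1.1 (stage A P (k + m)).side → p'.1.2 h = z h := by
    intro m p
    obtain ⟨g', y', h1, h2⟩ := exists_next_block hd hP z p.2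
    exact ⟨⟨(g', y'), h1⟩, h2⟩
  choose next hgrow hagree hz using step
  let p : ∀ m, T m := fun m => Nat.rec (⟨(g, y), hy⟩ : T 0) next m
  let Q : ℕ → Finset (Fin d → ℤ) := fun m => cube (p m).1.1 (stage A P (k + m)).side
  have hgrow' : ∀ m a, (p m).1.1 a + m ≤ g a ∧
      g a + m ≤ (p m).1.1 a + (stage A P (k + m)).side := by
    intro m a
    induction m with
    | zero =>
      refine ⟨le_of_eq (add_zero _), ?_⟩
      change g a + (0 : ℕ) ≤ g a + _
      push_cast
      omega
    | succ m ih =>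
      have := hgrow m (p m) a
      change _ ≤ _ ∧ _ ≤ (next m (p m)).1.1 a + _
      change (next m (p m)).1.1 a + _ ≤ _ ∧ _
      push_cast
      constructor <;> omega
  have hmono : ∀ m, Q m ⊆ Q (m + 1) := by
    intro m h hh
    have := hgrow m (p m)
    simp only [Q, mem_cube] at hh ⊢
    intro a
    have h1 := hh a
    have h2 := this a
    change (next m (p m)).1.1 a ≤ _ ∧ _ < (next m (p m)).1.1 a + _
    omega
  have hmono' : Monotone Q := monotone_nat_of_le_succ hmono
  have hagree' : ∀ m l, ∀ h ∈ Q m, (p (m + l)).1.2 h = (p m).1.2 h := by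
    intro m l h hh
    induction l with
    | zero => rfl
    | succ l ih =>
      rw [← ih]
      exact hagree (m + l) (p (m + l)) h (hmono' (Nat.le_add_right m l) hh)
  have hz' : ∀ m, ∀ h ∈ Q m, h ∈ P → h ∉ Q 0 → (p m).1.2 h = z h := by
    intro m
    induction m with
    | zero => exact fun h hh _ hn => absurd hh hn
    | succ m ih =>
      intro h hh hhP hn
      by_cases hm : h ∈ Q m
      · rw [hagree' m 1 h hm]; exact ih h hm hhP hn
      · exact hz m (p m) h hh hhP hm
  have hexhaust : ∀ N, ∃ m, window d N ⊆ Q m := by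
    intro N
    refine ⟨N + (∑ a, (g a).natAbs) + 1, fun h hh => mem_cube.2 fun a => ?_⟩
    have h1 := mem_window.1 hh a
    have h2 := hgrow' (N + (∑ a, (g a).natAbs) + 1) a
    have h3 : (g a).natAbs ≤ ∑ a, (g a).natAbs :=
      Finset.single_le_sum (f := fun a => (g a).natAbs) (fun _ _ => Nat.zero_le _)
        (Finset.mem_univ a)
    have h4 : ((N + (∑ a, (g a).natAbs) + 1 : ℕ) : ℤ) =
      N + ((∑ a, (g a).natAbs : ℕ) : ℤ) + 1 := by push_cast; ring
    rw [h4] at h2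
    omega
  have hex : ∀ h, ∃ m, h ∈ Q m := by
    intro h
    obtain ⟨N, hN⟩ := exists_subset_window {h}
    obtain ⟨m, hm⟩ := hexhaust N
    exact ⟨m, hm (hN (Finset.mem_singleton_self h))⟩
  choose μ hμ using hex
  have hlim : ∀ m, ∀ h ∈ Q m, (p (μ h)).1.2 h = (p m).1.2 h := by
    intro m h hh
    rcases le_total m (μ h) with hle | hle
    · obtain ⟨l, hl⟩ := Nat.exists_eq_add_of_le hle
      rw [hl]; exact hagree' m l h hh
    · obtain ⟨l, hl⟩ := Nat.exists_eq_add_of_le hle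
      rw [hl]; exact (hagree' (μ h) l h (hμ h)).symm
  refine ⟨fun h => (p (μ h)).1.2 h, fun N => ?_, fun h hh => hlim 0 h hh, fun h hhP hn => ?_⟩
  · obtain ⟨m, hm⟩ := hexhaust N
    exact ⟨k + m, (p m).1.1, (p m).1.2, (p m).2, hm, fun h hh => (hlim m h (hm hh)).symm⟩
  · exact hz' (μ h) h (hμ h) hhP hn

/-- The values of the points of the subshift on `P` are arbitrary, up to a finite set. -/
lemma exists_mem_eqOn_window (hd : 1 ≤ d) (hP : IsSparse P) {x : (Fin d → ℤ) → A}
    (hx : x ∈ (hierarchySubshift A P).carrier) (N : ℕ) (z : (Fin d → ℤ) → A) :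
    ∃ y ∈ (hierarchySubshift A P).carrier, (∀ h ∈ window d N, y h = x h) ∧
      ∃ D : Finset (Fin d → ℤ), ∀ h ∈ P, h ∉ D → y h = z h := by
  obtain ⟨k, g, w, h1, h2, h3⟩ := hx N
  obtain ⟨y, hy, hyw, hyz⟩ := exists_mem_of_isBlock hd hP h1 z
  exact ⟨y, hy, fun h hh => (hyw h (h2 hh)).trans (h3 h hh), _, hyz⟩

lemma hierarchySubshift_nonempty (hd : 1 ≤ d) (hP : IsSparse P) :
    (hierarchySubshift A P).carrier.Nonempty := by
  let z : (Fin d → ℤ) → A := fun _ => Classical.arbitrary A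
  obtain ⟨y, hy, -⟩ := stage_interpolates hd hP 0 0 z
  obtain ⟨x, hx, -⟩ := exists_mem_of_isBlock hd hP hy z
  exact ⟨x, hx⟩

end

/-! ### Entropy -/

/-- Fekete's lemma for quantities which are subadditive under the subdivision of cubes. -/
lemma exists_tendsto_div_pow {d : ℕ} {a : ℕ → ℝ} (h0 : ∀ n, 0 ≤ a n)
    (hsub : ∀ n m N : ℕ, 0 < n → N ≤ m * n → a N ≤ (m : ℝ) ^ d * a n) :
    ∃ h, Tendsto (fun n : ℕ => a n / (n : ℝ) ^ d) atTop (𝓝 h) := by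
  have hbdd : BddBelow (Set.range fun n : ℕ => a (n + 1) / ((n + 1 : ℕ) : ℝ) ^ d) :=
    ⟨0, by rintro _ ⟨n, rfl⟩; exact div_nonneg (h0 _) (by positivity)⟩
  refine ⟨⨅ n : ℕ, a (n + 1) / ((n + 1 : ℕ) : ℝ) ^ d, tendsto_order.2 ⟨fun b hb => ?_,
    fun b hb => ?_⟩⟩
  · filter_upwards [eventually_ge_atTop 1] with n hn
    obtain ⟨n, rfl⟩ := Nat.exists_eq_add_of_le' hn
    exact hb.trans_le (ciInf_le hbdd n)
  · obtain ⟨n, hn⟩ := exists_lt_of_ciInf_lt hb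
    have hnpos : (0 : ℝ) < ((n + 1 : ℕ) : ℝ) := by positivity
    have hlim : Tendsto (fun N : ℕ => (1 / ((n + 1 : ℕ) : ℝ) + 1 / (N : ℝ)) ^ d * a (n + 1)) atTop
        (𝓝 ((1 / ((n + 1 : ℕ) : ℝ) + 0) ^ d * a (n + 1))) :=
      ((tendsto_const_nhds.add tendsto_one_div_atTop_nhds_zero_nat).pow d).mul_const _
    have hlt : (1 / ((n + 1 : ℕ) : ℝ) + 0) ^ d * a (n + 1) < b := by
      rw [add_zero, one_div, inv_pow, mul_comm, ← div_eq_mul_inv]; exact hn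
    filter_upwards [hlim.eventually_lt_const hlt, eventually_ge_atTop 1] with N hN hN1
    refine lt_of_le_of_lt ?_ hN
    have hNpos : (0 : ℝ) < N := by exact_mod_cast hN1
    have h1 := hsub (n + 1) (N / (n + 1) + 1) N n.succ_pos (by
      have := Nat.lt_div_mul_add (a := N) (b := n + 1) n.succ_pos
      rw [add_mul, one_mul]; omega)
    rw [div_le_iff₀ (by positivity)]
    refine h1.trans ?_
    have h2 : ((N / (n + 1) + 1 : ℕ) : ℝ) ≤ (1 / ((n + 1 : ℕ) : ℝ) + 1 / (N : ℝ)) * N := by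
      have h3 : ((N / (n + 1) : ℕ) : ℝ) ≤ (N : ℝ) / ((n + 1 : ℕ) : ℝ) := Nat.cast_div_le
      have h4 : (1 / ((n + 1 : ℕ) : ℝ) + 1 / (N : ℝ)) * N = (N : ℝ) / ((n + 1 : ℕ) : ℝ) + 1 := by
        rw [add_mul, one_div_mul_cancel hNpos.ne', one_div_mul_eq_div]
      rw [h4, Nat.cast_add, Nat.cast_one]
      linarith
    have h5 := pow_le_pow_left₀ (Nat.cast_nonneg _) h2 d
    rw [mul_pow] at h5
    calc _ ≤ ((1 / ((n + 1 : ℕ) : ℝ) + 1 / (N : ℝ)) ^ d * (N : ℝ) ^ d) * a (n + 1) :=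
          mul_le_mul_of_nonneg_right h5 (h0 _)
      _ = _ := by ring

lemma patternsOnCube_finite {d : ℕ} {A : Type*} [Finite A] [TopologicalSpace A]
    (X : Subshift A (Fin d → ℤ)) (n : ℕ) : (patternsOnCube X n).Finite := Set.toFinite _

lemma ncard_patternsOnCube_le {d : ℕ} {A : Type*} [Finite A] [TopologicalSpace A]
    (X : Subshift A (Fin d → ℤ)) {n m N : ℕ} (hn : 0 < n) (hN : N ≤ m * n) :
    (patternsOnCube X N).ncard ≤ (patternsOnCube X n).ncard ^ m ^ d := by
  have hfin : Finite (patternsOnCube X n) := patternsOnCube_finite X n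
  choose x hxX hx using fun u : patternsOnCube X N => u.2
  let F : patternsOnCube X N → (Fin d → Fin m) → patternsOnCube X n := fun u j =>
    ⟨fun g => shift (fun a => ((j a : ℕ) : ℤ) * n) (x u) g, _,
      X.mapsTo _ (hxX u), rfl⟩
  have hF : Function.Injective F := by
    intro u v huv
    refine Subtype.ext ?_
    rw [← hx u, ← hx v]
    funext ⟨h, hh⟩
    have hh : ∀ a, 0 ≤ h a ∧ h a < N := by
      simpa [latticeBox, Fintype.mem_piFinset] using hh
    have hn' : (0 : ℤ) < n := by exact_mod_cast hn
    have hdiv : ∀ a, 0 ≤ h a / n ∧ h a / n < m := fun a => by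
      refine ⟨Int.ediv_nonneg (hh a).1 hn'.le, Int.ediv_lt_of_lt_mul hn' ?_⟩
      have : (N : ℤ) ≤ m * n := by exact_mod_cast hN
      linarith [(hh a).2]
    have h1 := congrFun huv fun a => ⟨(h a / n).toNat, by have := hdiv a; omega⟩
    have h2 := congrFun (congrArg Subtype.val h1) ⟨fun a => h a % n, by
      simp [latticeBox, Fintype.mem_piFinset, Int.emod_nonneg _ hn'.ne', Int.emod_lt_of_pos _ hn']⟩
    have h3 : ((fun a => (((h a / n).toNat : ℕ) : ℤ) * n) + fun a => h a % n) = h := by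
      funext a
      rw [Pi.add_apply, Int.toNat_of_nonneg (hdiv a).1]
      exact Int.ediv_mul_add_emod (h a) n
    simp only [F, SymbolicDynamics.FullShift.shift, h3] at h2
    exact h2
  have := Nat.card_le_card_of_injective F hF
  rw [Nat.card_fun] at this
  simpa [Set.ncard] using this

/-- A nonempty subshift has a topological entropy. -/
lemma exists_hasTopologicalEntropy {d : ℕ} {A : Type*} [Finite A] [TopologicalSpace A]
    (X : Subshift A (Fin d → ℤ)) (hX : X.carrier.Nonempty) : ∃ h, HasTopologicalEntropy X h := by
  have hpos : ∀ n, 0 < (patternsOnCube X n).ncard := fun n =>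
    (Set.ncard_pos (patternsOnCube_finite X n)).2 (hX.image _)
  refine exists_tendsto_div_pow (fun n => Real.log_natCast_nonneg _) fun n m N hn hN => ?_
  have h := ncard_patternsOnCube_le X hn hN
  have h1 : Real.log ((patternsOnCube X N).ncard : ℝ) ≤
      Real.log (((patternsOnCube X n).ncard : ℝ) ^ m ^ d) :=
    Real.log_le_log (by exact_mod_cast hpos N) (by exact_mod_cast h)
  rw [Real.log_pow] at h1
  exact_mod_cast h1

section
variable {d : ℕ} {A : Type*} [Fintype A] [Nonempty A] {P : Set (Fin d → ℤ)}

lemma exists_card_blocks_ge (hd : 1 ≤ d) (hP : IsSparse P) (k : ℕ) :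
    ∃ e : ℕ, Fintype.card A ^ e * 2 ≤ 2 ^ e * (stage A P k).blocks.card ∧
      ((stage A P k).side + 1) ^ d ≤ 2 ^ d * e := by
  classical
  induction k with
  | zero =>
    refine ⟨1, ?_, ?_⟩
    · have : (stage A P 0).blocks.card = Fintype.card A := by
        change (Finset.univ : Finset ((Fin d → Fin 1) → A)).card = _
        simp
      rw [this, pow_one, pow_one, mul_comm]
    · simp [stage]
  | succ k ih =>
    obtain ⟨e, h1, h2⟩ := ih
    have hL := admissible_scale (A := A) hd hP k
    have h3 := hL.card_blocks_le (stage_isValid hd hP k)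
    set L := scale P (stage A P k) k with hLdef
    have hL2 := hL.two_le
    change _ ≤ 2 * (stage A P (k + 1)).blocks.card at h3
    set K := (2 * L) ^ d with hK
    have hK2 : 2 ≤ K := (by omega : 2 ≤ 2 * L).trans (Nat.le_self_pow (by omega) _)
    refine ⟨e * K, ?_, ?_⟩
    · have h4 := Nat.pow_le_pow_left h1 K
      rw [mul_pow, mul_pow, ← pow_mul, ← pow_mul] at h4
      have h5 : 2 ^ 2 ≤ 2 ^ K := Nat.pow_le_pow_right two_pos hK2
      have h6 : Fintype.card A ^ (e * K) * 4 ≤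
          2 ^ (e * K) * (2 * (stage A P (k + 1)).blocks.card) :=
        (Nat.mul_le_mul_left _ h5).trans (h4.trans (Nat.mul_le_mul_left _ h3))
      nlinarith
    · have h4 : (stage A P (k + 1)).side + 1 ≤ 2 * L * ((stage A P k).side + 1) := by
        change 2 * L * (stage A P k).side + 1 + 1 ≤ _
        rw [mul_add]; omega
      calc _ ≤ (2 * L * ((stage A P k).side + 1)) ^ d := Nat.pow_le_pow_left h4 d
        _ = K * ((stage A P k).side + 1) ^ d := by rw [mul_pow]
        _ ≤ K * (2 ^ d * e) := Nat.mul_le_mul_left _ h2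
        _ = _ := by ring

lemma tendsto_side (hd : 1 ≤ d) (hP : IsSparse P) :
    Tendsto (fun k => (stage A P k).side) atTop atTop :=
  tendsto_atTop_mono (fun k => (Nat.le_mul_of_pos_right k (pow_pos k.factorial_pos d)).trans
    (stage_isValid (A := A) hd hP k).side_large) tendsto_id

variable [TopologicalSpace A] [DiscreteTopology A]

lemma card_blocks_le_ncard_patternsOnCube (hd : 1 ≤ d) (hP : IsSparse P) (k : ℕ) :
    (stage A P k).blocks.card ≤
      (patternsOnCube (hierarchySubshift A P) (stage A P k).side).ncard := by
  classical
  have hex : ∀ w ∈ (stage A P k).blocks, ∃ x ∈ (hierarchySubshift A P).carrier,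
      pattern (stage A P k).side x 0 = w := by
    intro w hw
    obtain ⟨y, hy⟩ := exists_pattern_eq w 0
    obtain ⟨x, hx, hxy, -⟩ := exists_mem_of_isBlock hd hP (k := k) (g := 0) (y := y)
      (by unfold Stage.IsBlock; rwa [hy]) y
    exact ⟨x, hx, (pattern_congr hxy).trans hy⟩
  choose! x hxX hx using hex
  rw [← Set.ncard_coe_finset]
  refine Set.ncard_le_ncard_of_injOn (fun w g => x w g)
    (fun w hw => ⟨x w, hxX w hw, rfl⟩) ?_ (patternsOnCube_finite _ _)
  intro w hw w' hw' h
  rw [← hx w hw, ← hx w' hw', pattern_eq_iff]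
  intro i hi
  simpa using congrFun h ⟨i, hi⟩

/-- The entropy of the subshift is large if the alphabet is large. -/
lemma le_entropy (hd : 1 ≤ d) (hP : IsSparse P) (hA : 2 ≤ Fintype.card A) {h : ℝ}
    (hh : HasTopologicalEntropy (hierarchySubshift A P) h) :
    Real.log (Fintype.card A / 2) / 2 ^ d ≤ h := by
  refine ge_of_tendsto (hh.comp (tendsto_side (A := A) hd hP)) (Eventually.of_forall fun k => ?_)
  obtain ⟨e, h1, h2⟩ := exists_card_blocks_ge (A := A) hd hP k
  have hA' : (2 : ℝ) ≤ Fintype.card A := by exact_mod_cast hA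
  have hlog : 0 ≤ Real.log (Fintype.card A / 2) := Real.log_nonneg (by linarith)
  have hside : (0 : ℝ) < (stage A P k).side := by
    exact_mod_cast (stage_isValid (A := A) hd hP k).side_pos
  have h3 := h1.trans (Nat.mul_le_mul_left _ (card_blocks_le_ncard_patternsOnCube hd hP k))
  set p := (patternsOnCube (hierarchySubshift A P) (stage A P k).side).ncard with hp
  have h4 : ((Fintype.card A : ℝ) / 2) ^ e ≤ p := by
    rw [div_pow, div_le_iff₀ (by positivity)]
    have : (Fintype.card A ^ e : ℝ) * 2 ≤ 2 ^ e * p := by exact_mod_cast h3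
    have h0 : (0 : ℝ) ≤ (Fintype.card A : ℝ) ^ e := by positivity
    linarith
  have h5 : e * Real.log (Fintype.card A / 2) ≤ Real.log p := by
    rw [← Real.log_pow]
    exact Real.log_le_log (by positivity) h4
  have h6 : ((stage A P k).side : ℝ) ^ d ≤ 2 ^ d * e := by
    have : (((stage A P k).side : ℝ) + 1) ^ d ≤ 2 ^ d * e := by exact_mod_cast h2
    exact (pow_le_pow_left₀ hside.le (by linarith) d).trans this
  simp only [Function.comp_apply]
  rw [div_le_div_iff₀ (by positivity) (by positivity)]
  calc _ ≤ Real.log (Fintype.card A / 2) * (2 ^ d * e) := mul_le_mul_of_nonneg_left h6 hlog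
    _ = (e * Real.log (Fintype.card A / 2)) * 2 ^ d := by ring
    _ ≤ _ := mul_le_mul_of_nonneg_right h5 (by positivity)

end

/-! ### Uniform convergence of lattice averages -/

/-- The sum of the values `f (T^h x)` over the points `h` of `B` which lie in `(qℤ)^d`. -/
def latticeSum {d : ℕ} {A : Type*} (q : ℕ) (f : ((Fin d → ℤ) → A) → ℝ) (x : (Fin d → ℤ) → A)
    (B : Finset (Fin d → ℤ)) : ℝ :=
  ∑ h ∈ B with residue q h = 0, f fun i => x (h + i)

/-- The function `f` takes values in `[0, 1]` and depends on the coordinates in `[-l, l]^d` only. -/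
structure IsLocal {d : ℕ} {A : Type*} (f : ((Fin d → ℤ) → A) → ℝ) (l : ℕ) : Prop where
  nonneg : ∀ x, 0 ≤ f x
  le_one : ∀ x, f x ≤ 1
  congr : ∀ x y, (∀ h ∈ window d l, x h = y h) → f x = f y

lemma IsLocal.latticeSum_nonneg {d : ℕ} {A : Type*} {f : ((Fin d → ℤ) → A) → ℝ} {l : ℕ}
    (hf : IsLocal f l) (q : ℕ) (x : (Fin d → ℤ) → A) (B : Finset (Fin d → ℤ)) :
    0 ≤ latticeSum q f x B := Finset.sum_nonneg fun _ _ => hf.nonneg _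

lemma IsLocal.latticeSum_le_card {d : ℕ} {A : Type*} {f : ((Fin d → ℤ) → A) → ℝ} {l : ℕ}
    (hf : IsLocal f l) (q : ℕ) (x : (Fin d → ℤ) → A) (B : Finset (Fin d → ℤ)) :
    latticeSum q f x B ≤ B.card := by
  refine (Finset.sum_le_card_nsmul _ _ 1 fun _ _ => hf.le_one _).trans ?_
  rw [nsmul_one]
  exact_mod_cast Finset.card_filter_le _ _

/-- Splitting off disjoint parts changes a lattice sum by at most the number of points left out. -/
lemma IsLocal.abs_latticeSum_sub_le {d : ℕ} {A ι : Type*} {f : ((Fin d → ℤ) → A) → ℝ} {l : ℕ}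
    (hf : IsLocal f l) (q : ℕ) (x : (Fin d → ℤ) → A) {B : Finset (Fin d → ℤ)} {T : Finset ι}
    {C : ι → Finset (Fin d → ℤ)} (hC : ∀ t ∈ T, C t ⊆ B)
    (hdisj : (T : Set ι).PairwiseDisjoint C) :
    |latticeSum q f x B - ∑ t ∈ T, latticeSum q f x (C t)| ≤
      B.card - ∑ t ∈ T, ((C t).card : ℝ) := by
  classical
  have hsub : T.biUnion C ⊆ B := Finset.biUnion_subset.2 hC
  have h1 : ∑ t ∈ T, latticeSum q f x (C t) = latticeSum q f x (T.biUnion C) := by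
    unfold latticeSum
    rw [Finset.filter_biUnion, Finset.sum_biUnion]
    exact fun s hs t ht hst => (hdisj hs ht hst).mono (Finset.filter_subset _ _)
      (Finset.filter_subset _ _)
  have h2 : latticeSum q f x B =
      latticeSum q f x (B \ T.biUnion C) + latticeSum q f x (T.biUnion C) := by
    simp only [latticeSum, Finset.sum_filter]
    exact (Finset.sum_sdiff hsub).symm
  have h3 : (B.card : ℝ) - ∑ t ∈ T, ((C t).card : ℝ) = (B \ T.biUnion C).card := by
    rw [Finset.cast_card_sdiff hsub, Finset.card_biUnion hdisj]
    push_cast; rfl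
  rw [h1, h2, h3, add_sub_cancel_right, abs_of_nonneg (hf.latticeSum_nonneg _ _ _)]
  exact hf.latticeSum_le_card _ _ _

/-- The lattice sum over the interior of a cube is determined by the pattern on the cube and by the
residue of its position: at distance `l` from the boundary, all coordinates on which `f` depends
belong to the cube. -/
lemma IsLocal.latticeSum_interior_eq {d : ℕ} {A : Type*} {f : ((Fin d → ℤ) → A) → ℝ} {l : ℕ}
    (hf : IsLocal f l) (q : ℕ) {n : ℕ} (hn : 2 * l ≤ n) {x e : (Fin d → ℤ) → A} {g : Fin d → ℤ}
    (he : pattern n e 0 = pattern n x g) :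
    latticeSum q f x (cube (g + fun _ => (l : ℤ)) (n - 2 * l)) =
      ∑ i ∈ cube (fun _ : Fin d => (l : ℤ)) (n - 2 * l),
        if residue q g + residue q i = 0 then f (fun h => e (i + h)) else 0 := by
  rw [latticeSum, Finset.sum_filter]
  symm
  refine Finset.sum_bij (fun i _ => g + i) (fun i hi => add_mem_cube.2 hi)
    (fun i _ j _ h => add_left_cancel h) (fun h hh => ⟨h - g, ?_, add_sub_cancel _ _⟩)
    fun i hi => ?_
  · rw [← add_sub_cancel g h] at hh
    exact add_mem_cube.1 hh
  · rw [residue_add]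
    refine if_congr Iff.rfl (hf.congr _ _ fun h hh => ?_) rfl
    rw [pattern_eq_iff] at he
    rw [add_assoc, ← he (i + h), zero_add]
    rw [mem_cube] at hi ⊢
    intro a
    have h1 := hi a
    have h2 := mem_window.1 hh a
    simp only [Pi.add_apply, Pi.zero_apply]
    omega

/-- The proportion of a large cube which is filled by the interiors of smaller cubes. -/
lemma one_sub_le_filled {d : ℕ} {K n l : ℝ} (hK : 1 ≤ K) (hl : 0 ≤ l) (hn : 2 * l + 1 ≤ n) :
    (K * n + 1) ^ d * (1 - d * ((2 * l + 1) / n)) ≤ (K * (n - 2 * l)) ^ d := by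
  have hn0 : 0 < n := by linarith
  set a := (2 * l + 1) / n with ha
  have ha1 : a ≤ 1 := (div_le_one hn0).2 hn
  have h1 : 1 - d * a ≤ (1 - a) ^ d := by
    have := one_add_mul_le_pow (a := -a) (by linarith) d
    rw [← sub_eq_add_neg] at this
    linarith
  have h2 : (K * n + 1) * (1 - a) ≤ K * (n - 2 * l) := by
    have : (K * n + 1) * (1 - a) = K * (n - 2 * l) - (K - 1) - a := by
      rw [ha]; field_simp; ring
    have : 0 ≤ a := by positivity
    linarith
  calc _ ≤ (K * n + 1) ^ d * (1 - a) ^ d := mul_le_mul_of_nonneg_left h1 (by positivity)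
    _ = ((K * n + 1) * (1 - a)) ^ d := (mul_pow _ _ _).symm
    _ ≤ _ := pow_le_pow_left₀ (mul_nonneg (by positivity) (by linarith)) h2 d

open Classical in
/-- If the blocks in the slots are balanced, then any weights have nearly the expected sum. -/
lemma IsBalanced.abs_sum_sub_le {J R T : Type*} [Fintype J] [Fintype R] {cls : J → R}
    {V : Finset T} {M ε : ℝ} {u : J → T} (hu : IsBalanced cls V M ε u) (huV : ∀ j, u j ∈ V)
    (Φ : R → T → ℝ) (hΦ : ∀ ρ v, 0 ≤ Φ ρ v) :
    |(V.card : ℝ) * ∑ j, Φ (cls j) (u j) - M * ∑ ρ, ∑ v ∈ V, Φ ρ v| ≤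
      ε * M * ∑ ρ, ∑ v ∈ V, Φ ρ v := by
  have h1 : ∑ j, Φ (cls j) (u j) = ∑ ρ, ∑ v ∈ V,
      ((Finset.univ.filter fun j => cls j = ρ ∧ u j = v).card : ℝ) * Φ ρ v := by
    rw [← Finset.sum_product', ← Finset.sum_fiberwise_of_maps_to
      (g := fun j => (cls j, u j)) (t := Finset.univ ×ˢ V)
      (fun j _ => Finset.mem_product.2 ⟨Finset.mem_univ _, huV j⟩)]
    refine Finset.sum_congr rfl fun p _ => ?_
    rw [← nsmul_eq_mul, ← Finset.sum_const]
    refine Finset.sum_congr ?_ fun j hj => ?_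
    · ext j; simp [Prod.ext_iff]
    · have := (Finset.mem_filter.1 hj).2
      rw [this.1, this.2]
  have h2 : (V.card : ℝ) * ∑ j, Φ (cls j) (u j) - M * ∑ ρ, ∑ v ∈ V, Φ ρ v =
      ∑ ρ, ∑ v ∈ V, ((V.card : ℝ) *
        ((Finset.univ.filter fun j => cls j = ρ ∧ u j = v).card : ℝ) - M) * Φ ρ v := by
    rw [h1]
    simp_rw [sub_mul, Finset.sum_sub_distrib, Finset.mul_sum, mul_assoc]
  rw [h2, Finset.mul_sum]
  refine (Finset.abs_sum_le_sum_abs _ _).trans (Finset.sum_le_sum fun ρ _ => ?_)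
  rw [Finset.mul_sum]
  refine (Finset.abs_sum_le_sum_abs _ _).trans (Finset.sum_le_sum fun v hv => ?_)
  rw [abs_mul, abs_of_nonneg (hΦ ρ v)]
  exact mul_le_mul_of_nonneg_right (hu ρ v hv) (hΦ ρ v)

lemma tolerance_le {ε : ℝ} (hε : 0 < ε) {k : ℕ} (hk : 2 / ε ≤ k) : tolerance k ≤ ε / 2 := by
  rw [tolerance, div_le_div_iff₀ (by positivity) two_pos]
  rw [div_le_iff₀ hε] at hk
  linarith

section
variable {d : ℕ} {A : Type*} [Fintype A] [Nonempty A] {P : Set (Fin d → ℤ)}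

set_option maxHeartbeats 800000 in
/-- In all blocks of a high stage, a local function has nearly the same lattice average, no matter
how the blocks are placed with respect to the lattice. -/
lemma eventually_abs_latticeSum_block_le (hd : 1 ≤ d) (hP : IsSparse P)
    {f : ((Fin d → ℤ) → A) → ℝ} {l : ℕ} (hf : IsLocal f l) {ε : ℝ} (hε : 0 < ε) :
    ∀ᶠ k in atTop, ∃ c : ℝ, 0 ≤ c ∧ c ≤ 1 ∧ ∀ x g, (stage A P (k + 1)).IsBlock x g →
      |latticeSum k.factorial f x (cube g (stage A P (k + 1)).side) -
        c * (((stage A P (k + 1)).side : ℝ) ^ d / (k.factorial : ℝ) ^ d)| ≤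
          ε * (((stage A P (k + 1)).side : ℝ) ^ d / (k.factorial : ℝ) ^ d) := by
  classical
  obtain ⟨B, hB⟩ := exists_nat_ge (2 * d * (2 * l + 1) / ε + 2 / ε)
  filter_upwards [eventually_ge_atTop (B + 2 * l + 1)] with k hk
  have hp1 : 0 ≤ 2 * d * (2 * l + 1) / ε := by positivity
  have hp2 : 0 < 2 / ε := by positivity
  have hkB : (B : ℝ) ≤ k := by exact_mod_cast (show B ≤ k by omega)
  have hS := stage_isValid (A := A) hd hP k
  have hL := admissible_scale (A := A) hd hP k
  have hnext : stage A P (k + 1) =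
    (stage A P k).next (scale P (stage A P k) k) k.factorial (tolerance k) := rfl
  rw [hnext]
  generalize stage A P k = S at *
  generalize scale P S k = L at *
  have : NeZero k.factorial := ⟨k.factorial_ne_zero⟩
  have hside : (S.next L k.factorial (tolerance k)).side = 2 * L * S.side + 1 := rfl
  rw [hside]
  have hqfac : (1 : ℝ) ≤ k.factorial := by exact_mod_cast k.factorial_pos
  have hdvd : k.factorial ∣ 2 * L :=
    ((Nat.factorial_dvd_factorial k.le_succ).trans hL.dvd).mul_left 2
  set q : ℝ := (k.factorial : ℝ) with hq
  set n : ℝ := (S.side : ℝ) with hn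
  set K : ℝ := 2 * (L : ℝ) with hK
  set n' : ℝ := K * n + 1 with hn'
  have hcastn' : ((2 * L * S.side + 1 : ℕ) : ℝ) = n' := by push_cast; rfl
  rw [hcastn']
  set V : ℝ := (S.blocks.card : ℝ) with hV
  have hVpos : 0 < V := by rw [hV]; exact_mod_cast hS.nonempty.card_pos
  have hM : (classSize d L k.factorial : ℝ) = K ^ d / q ^ d := by
    rw [classSize, Nat.cast_pow, Nat.cast_div hdvd (by exact_mod_cast k.factorial_ne_zero)]
    rw [div_pow]; push_cast; rfl
  have hkn : (k : ℝ) * q ^ d ≤ n := by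
    have := hS.side_large
    rw [hn, hq]; exact_mod_cast this
  have hqd : 1 ≤ q ^ d := one_le_pow₀ hqfac
  have hk0 : (0 : ℝ) ≤ k := Nat.cast_nonneg k
  have hkn' : (k : ℝ) ≤ n := (le_mul_of_one_le_right hk0 hqd).trans hkn
  have hl0 : (0 : ℝ) ≤ l := Nat.cast_nonneg l
  have hkl : 2 * (l : ℝ) + 1 ≤ k := by exact_mod_cast (show 2 * l + 1 ≤ k by omega)
  have hnpos : 0 < n := by linarith
  have hK1 : 1 ≤ K := by
    have : (2 : ℝ) ≤ L := by exact_mod_cast hL.two_le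
    linarith
  have hn'pos : 0 < n' := by positivity
  have hln : 2 * l ≤ S.side := by
    have : 2 * (l : ℝ) ≤ n := by linarith
    rw [hn] at this; exact_mod_cast this
  choose e he using fun w => exists_pattern_eq (A := A) (n := S.side) w (0 : Fin d → ℤ)
  -- the lattice sum over the interior of a block `v` at a position with residue `τ`
  let Φ : (Fin d → ZMod k.factorial) → ((Fin d → Fin S.side) → A) → ℝ := fun τ v =>
    ∑ i ∈ cube (fun _ : Fin d => (l : ℤ)) (S.side - 2 * l),
      if τ + residue k.factorial i = 0 then f (fun h => e v (i + h)) else 0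
  have hΦ : ∀ τ v, 0 ≤ Φ τ v := fun τ v => Finset.sum_nonneg fun i _ => by
    split_ifs
    · exact hf.nonneg _
    · exact le_rfl
  let Ψ : ℝ := ∑ τ, ∑ v ∈ S.blocks, Φ τ v
  have hΨ0 : 0 ≤ Ψ := Finset.sum_nonneg fun τ _ => Finset.sum_nonneg fun v _ => hΦ τ v
  have hΨ1 : Ψ ≤ V * n ^ d := by
    simp only [Ψ]
    rw [Finset.sum_comm]
    have : ∀ v ∈ S.blocks, ∑ τ, Φ τ v ≤ n ^ d := by
      intro v _
      simp only [Φ]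
      rw [Finset.sum_comm]
      calc _ ≤ ∑ i ∈ cube (fun _ : Fin d => (l : ℤ)) (S.side - 2 * l), (1 : ℝ) := by
            refine Finset.sum_le_sum fun i _ => ?_
            rw [Finset.sum_eq_single (-residue k.factorial i)]
            · simpa using hf.le_one _
            · intro τ _ hτ
              rw [if_neg]
              exact fun h => hτ (eq_neg_of_add_eq_zero_left h)
            · simp
        _ = ((S.side - 2 * l : ℕ) : ℝ) ^ d := by
            rw [Finset.sum_const, card_cube, nsmul_one]; push_cast; rfl
        _ ≤ n ^ d := pow_le_pow_left₀ (Nat.cast_nonneg _) (by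
            rw [hn]; exact_mod_cast Nat.sub_le _ _) d
    calc _ ≤ ∑ v ∈ S.blocks, n ^ d := Finset.sum_le_sum this
      _ = _ := by rw [Finset.sum_const, nsmul_eq_mul]
  have hKn : K ^ d * n ^ d ≤ n' ^ d := by
    rw [← mul_pow]; exact pow_le_pow_left₀ (by positivity) (by linarith) d
  refine ⟨K ^ d * Ψ / (V * n' ^ d), by positivity, ?_, fun x g hx => ?_⟩
  · rw [div_le_one (by positivity)]
    calc _ ≤ K ^ d * (V * n ^ d) := mul_le_mul_of_nonneg_left hΨ1 (by positivity)
      _ = V * (K ^ d * n ^ d) := by ring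
      _ ≤ _ := mul_le_mul_of_nonneg_left hKn hVpos.le
  rw [Stage.isBlock_next] at hx
  obtain ⟨hxb, hbal⟩ := hx
  -- the interiors of the slots
  let C : (Fin d → Fin (2 * L)) → Finset (Fin d → ℤ) := fun j =>
    cube (g + slotPos S.side L j + fun _ => (l : ℤ)) (S.side - 2 * l)
  have hCsub : ∀ j, C j ⊆ cube (g + slotPos S.side L j) S.side := by
    intro j h hh
    rw [mem_cube] at hh ⊢
    intro a
    have := hh a
    rw [Pi.add_apply _ (fun _ => (l : ℤ))] at this
    omega
  have hCB : ∀ j ∈ Finset.univ, C j ⊆ cube g (2 * L * S.side + 1) := fun j _ =>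
    (hCsub j).trans (cube_slotPos_subset g j)
  have hCdisj : ((Finset.univ : Finset (Fin d → Fin (2 * L))) : Set _).PairwiseDisjoint C := by
    intro i _ j _ hij
    refine Finset.disjoint_left.2 fun h hi hj => hij ?_
    exact eq_of_mem_cube_slotPos (hCsub i hi) (hCsub j hj)
  have hmain := hf.abs_latticeSum_sub_le k.factorial x hCB hCdisj
  have hCcard : ∑ j, ((C j).card : ℝ) = (K * (n - 2 * l)) ^ d := by
    have : ∀ j, ((C j).card : ℝ) = (n - 2 * l) ^ d := fun j => by
      simp only [C]
      rw [card_cube, Nat.cast_pow, Nat.cast_sub hln]; push_cast; rfl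
    simp only [this, Finset.sum_const, Finset.card_univ, Fintype.card_fun, Fintype.card_fin,
      nsmul_eq_mul]
    push_cast
    rw [hK, mul_pow (2 * (L : ℝ)), mul_pow 2]
  rw [hCcard, card_cube, Nat.cast_pow, hcastn'] at hmain
  have hfill := one_sub_le_filled (d := d) hK1 hl0 (hkl.trans hkn')
  rw [← hn'] at hfill
  have hsmall : n' ^ d - (K * (n - 2 * l)) ^ d ≤ ε / 2 * (n' ^ d / q ^ d) := by
    have h1 : d * ((2 * l + 1) / n) ≤ ε / 2 / q ^ d := by
      rw [← mul_div_assoc, div_le_div_iff₀ hnpos (by positivity)]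
      have h2 : 2 * d * (2 * l + 1) / ε ≤ k := by linarith
      rw [div_le_iff₀ hε] at h2
      have h3 : ε / 2 * ((k : ℝ) * q ^ d) ≤ ε / 2 * n := by gcongr
      have h2' := mul_le_mul_of_nonneg_right h2 (zero_le_one.trans hqd)
      refine le_trans (le_of_eq_of_le ?_ (div_le_div_of_nonneg_right h2' zero_le_two))
        (le_of_eq_of_le ?_ h3) <;> ring
    have h4 := mul_le_mul_of_nonneg_left h1 (show 0 ≤ n' ^ d by positivity)
    have h5 : n' ^ d * (ε / 2 / q ^ d) = ε / 2 * (n' ^ d / q ^ d) := by ring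
    rw [h5] at h4
    linarith
  have hterm : ∀ j, latticeSum k.factorial f x (C j) =
      Φ (residue k.factorial g + residue k.factorial (slotPos S.side L j))
        (pattern S.side x (g + slotPos S.side L j)) := fun j => by
    have := hf.latticeSum_interior_eq k.factorial hln
      (he (pattern S.side x (g + slotPos S.side L j)))
    rw [residue_add] at this
    exact this
  have hbal' := hbal.abs_sum_sub_le hxb (fun ρ v => Φ (residue k.factorial g + ρ) v)
    fun ρ v => hΦ _ v
  have hΨeq : ∑ ρ, ∑ v ∈ S.blocks, Φ (residue k.factorial g + ρ) v = Ψ :=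
    Equiv.sum_comp (Equiv.addLeft (residue k.factorial g)) fun τ => ∑ v ∈ S.blocks, Φ τ v
  rw [hΨeq, ← hV, hM] at hbal'
  have hsum : ∑ j, latticeSum k.factorial f x (C j) =
      ∑ j, Φ (residue k.factorial g + residue k.factorial (slotPos S.side L j))
        (pattern S.side x (g + slotPos S.side L j)) := Finset.sum_congr rfl fun j _ => hterm j
  rw [← hsum] at hbal'
  set s₀ := ∑ j, latticeSum k.factorial f x (C j) with hs₀
  have hc : K ^ d * Ψ / (V * n' ^ d) * (n' ^ d / q ^ d) = K ^ d / q ^ d * Ψ / V := by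
    field_simp
  rw [hc]
  have htol : tolerance k ≤ ε / 2 := tolerance_le hε (by linarith)
  have hbal'' : |s₀ - K ^ d / q ^ d * Ψ / V| ≤ ε / 2 * (n' ^ d / q ^ d) := by
    have h1 : V * |s₀ - K ^ d / q ^ d * Ψ / V| = |V * s₀ - K ^ d / q ^ d * Ψ| := by
      rw [← abs_of_pos hVpos, ← abs_mul, abs_of_pos hVpos, mul_sub, mul_div_cancel₀ _ hVpos.ne']
    have h2 : tolerance k * (K ^ d / q ^ d) * Ψ ≤ V * (ε / 2 * (n' ^ d / q ^ d)) := by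
      calc tolerance k * (K ^ d / q ^ d) * Ψ ≤ ε / 2 * (K ^ d / q ^ d) * (V * n ^ d) := by
            gcongr
        _ = V * (ε / 2 * (K ^ d * n ^ d / q ^ d)) := by ring
        _ ≤ _ := by gcongr
    exact le_of_mul_le_mul_left (h1 ▸ hbal'.trans h2) hVpos
  calc _ = |(latticeSum k.factorial f x (cube g (2 * L * S.side + 1)) - s₀) +
        (s₀ - K ^ d / q ^ d * Ψ / V)| := by ring_nf
    _ ≤ _ := abs_add_le _ _
    _ ≤ ε / 2 * (n' ^ d / q ^ d) + ε / 2 * (n' ^ d / q ^ d) :=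
        add_le_add (hmain.trans hsmall) hbal''
    _ = _ := by ring

/-- The positions of the blocks of stage `k` in a block of stage `m`, in each coordinate: they are
separated by at least the side length, and gaps have length at most one. -/
lemma exists_positions (hd : 1 ≤ d) (hP : IsSparse P) {k m : ℕ} (hkm : k ≤ m) :
    ∃ T : Finset ℕ, (∀ t ∈ T, t + (stage A P k).side ≤ (stage A P m).side) ∧
      (∀ s ∈ T, ∀ t ∈ T, s < t → s + (stage A P k).side ≤ t) ∧
      (∀ a ≤ (stage A P m).side, ∃ t ∈ T, t ≤ a ∧ a ≤ t + (stage A P k).side) ∧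
      ∀ x g, (stage A P m).IsBlock x g → ∀ t : Fin d → ℕ, (∀ a, t a ∈ T) →
        (stage A P k).IsBlock x (g + fun a => (t a : ℤ)) := by
  induction m, hkm using Nat.le_induction with
  | base =>
    refine ⟨{0}, by simp, by simp, by simp, fun x g hx t ht => ?_⟩
    have : (fun a => (t a : ℤ)) = 0 := by
      funext a; simpa using ht a
    rwa [this, add_zero]
  | succ m hkm ih =>
    obtain ⟨T, h1, h2, h3, h4⟩ := ih
    have hL := (admissible_scale (A := A) hd hP m).two_le
    have hnpos := (stage_isValid (A := A) hd hP m).side_pos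
    have hiff : ∀ x g, (stage A P (m + 1)).IsBlock x g → ∀ j, (stage A P m).IsBlock x
        (g + slotPos (stage A P m).side (scale P (stage A P m) m) j) := fun x g h =>
      (Stage.isBlock_next.1 h).1
    have hside : (stage A P (m + 1)).side =
      2 * scale P (stage A P m) m * (stage A P m).side + 1 := rfl
    generalize scale P (stage A P m) m = L at *
    generalize hn : (stage A P m).side = n at *
    refine ⟨(Finset.range (2 * L) ×ˢ T).image fun p => slot n L p.1 + p.2, ?_, ?_, ?_, ?_⟩
    · intro t ht
      obtain ⟨⟨j, s⟩, hjs, rfl⟩ := Finset.mem_image.1 ht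
      obtain ⟨hj, hs⟩ := Finset.mem_product.1 hjs
      have := slot_add_le_side (n := n) (L := L) (j := j) (Finset.mem_range.1 hj)
      have : s + _ ≤ _ := h1 s hs
      simp only
      omega
    · intro s hs t ht hst
      obtain ⟨⟨i, s⟩, his, rfl⟩ := Finset.mem_image.1 hs
      obtain ⟨⟨j, t⟩, hjt, rfl⟩ := Finset.mem_image.1 ht
      have hsT : s ∈ T := (Finset.mem_product.1 his).2
      have htT : t ∈ T := (Finset.mem_product.1 hjt).2
      simp only at hst ⊢
      have hs1 := h1 s hsT
      have ht1 := h1 t htT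
      rcases lt_trichotomy i j with h | rfl | h
      · have := slot_add_le (n := n) (L := L) h; omega
      · have := h2 s hsT t htT (by omega); omega
      · have := slot_add_le (n := n) (L := L) h
        omega
    · intro a ha
      rw [hside] at ha
      obtain ⟨j, hj, hja, haj⟩ : ∃ j < 2 * L, slot n L j ≤ a ∧ a ≤ slot n L j + n := by
        have hdm : ∀ b, b / n * n ≤ b ∧ b < b / n * n + n := fun b =>
          ⟨Nat.div_mul_le_self b n, Nat.lt_div_mul_add hnpos⟩
        have hexp : 2 * L * n = L * n + L * n := by ring
        have hpred : ∀ M, 1 ≤ M → (M - 1) * n + n = M * n := fun M hM => by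
          obtain ⟨r, rfl⟩ := Nat.exists_eq_add_of_le' hM
          simp [add_mul]
        rcases lt_trichotomy a (L * n) with h | h | h
        · have hlt : a / n < L := Nat.div_lt_of_lt_mul (by rwa [mul_comm])
          refine ⟨a / n, by omega, ?_⟩
          have := hdm a
          simp only [slot, if_pos hlt]
          omega
        · have hlt : L - 1 < L := by omega
          refine ⟨L - 1, by omega, ?_⟩
          have := hpred L (by omega)
          simp only [slot, if_pos hlt]
          omega
        · rcases Nat.lt_or_ge (a - 1) (2 * L * n) with h' | h'
          · have hlt : (a - 1) / n < 2 * L := Nat.div_lt_of_lt_mul (by rwa [mul_comm])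
            have hge : ¬ (a - 1) / n < L := by
              rw [not_lt, Nat.le_div_iff_mul_le hnpos]; omega
            refine ⟨(a - 1) / n, hlt, ?_⟩
            have := hdm (a - 1)
            simp only [slot, if_neg hge]
            omega
          · have hge : ¬ 2 * L - 1 < L := by omega
            refine ⟨2 * L - 1, by omega, ?_⟩
            have := hpred (2 * L) (by omega)
            simp only [slot, if_neg hge]
            omega
      obtain ⟨t, ht, hta, hat⟩ := h3 (a - slot n L j) (by omega)
      refine ⟨slot n L j + t, Finset.mem_image.2
        ⟨(j, t), Finset.mem_product.2 ⟨Finset.mem_range.2 hj, ht⟩, rfl⟩, ?_, ?_⟩ <;> omega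
    · intro x g hx t ht
      have : ∀ a, ∃ j : Fin (2 * L), ∃ s ∈ T, slot n L j + s = t a := fun a => by
        obtain ⟨⟨j, s⟩, hjs, h⟩ := Finset.mem_image.1 (ht a)
        obtain ⟨hj, hs⟩ := Finset.mem_product.1 hjs
        exact ⟨⟨j, Finset.mem_range.1 hj⟩, s, hs, h⟩
      choose j s hs hjs using this
      have := h4 x _ (hiff x g hx j) s hs
      have heq : (g + fun a => (t a : ℤ)) = g + slotPos n L j + fun a => (s a : ℤ) := by
        funext a
        simp only [Pi.add_apply, slotPos, ← hjs a]
        push_cast; ring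
      rwa [heq]

lemma side_strictMono (hd : 1 ≤ d) (hP : IsSparse P) :
    StrictMono fun k => (stage A P k).side := by
  refine strictMono_nat_of_lt_succ fun k => ?_
  have h1 := (admissible_scale (A := A) hd hP k).two_le
  change _ < 2 * scale P (stage A P k) k * (stage A P k).side + 1
  have : (stage A P k).side ≤ 2 * scale P (stage A P k) k * (stage A P k).side :=
    Nat.le_mul_of_pos_left _ (by omega)
  omega

variable [TopologicalSpace A] [DiscreteTopology A]

/-- A large cube in a point of the subshift is nearly tiled by blocks of stage `k`. -/
lemma exists_disjoint_blocks (hd : 1 ≤ d) (hP : IsSparse P) {x : (Fin d → ℤ) → A}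
    (hx : x ∈ (hierarchySubshift A P).carrier) {k N : ℕ} (hN : (stage A P k).side ≤ N) :
    ∃ T : Finset (Fin d → ℤ), (∀ t ∈ T, (stage A P k).IsBlock x t) ∧
      (∀ t ∈ T, cube t (stage A P k).side ⊆ cube 0 N) ∧
      ((T : Set (Fin d → ℤ)).PairwiseDisjoint fun t => cube t (stage A P k).side) ∧
      (N - 2 * (stage A P k).side - 2) ^ d ≤ T.card * ((stage A P k).side + 1) ^ d := by
  classical
  obtain ⟨m, g, y, hy, hsub, hyx⟩ := hx N
  have hmono := side_strictMono (A := A) hd hP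
  have hcorner : ∀ h : Fin d → ℤ, (∀ a, 0 ≤ h a ∧ h a ≤ N) → h ∈ window d N := fun h hh =>
    mem_window.2 fun a => ⟨by have := (hh a).1; omega, (hh a).2⟩
  have hg : ∀ a, g a ≤ 0 ∧ (N : ℤ) < g a + (stage A P m).side := fun a => by
    have h1 := mem_cube.1 (hsub (hcorner 0 fun a => by simp)) a
    have h2 := mem_cube.1 (hsub (hcorner (fun _ => N) fun a => by simp)) a
    simp only [Pi.zero_apply] at h1
    omega
  have hkm : k ≤ m := by
    rw [← hmono.le_iff_le]
    have := hg ⟨0, hd⟩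
    have h3 := mem_cube.1 (hsub (hcorner 0 fun a => by simp)) ⟨0, hd⟩
    have h5 : (fun _ => -(N : ℤ)) ∈ window d N := mem_window.2 fun a => ⟨le_rfl, by omega⟩
    have h4 := mem_cube.1 (hsub h5) ⟨0, hd⟩
    omega
  obtain ⟨T, hT1, hT2, hT3, hT4⟩ := exists_positions (A := A) hd hP hkm
  set n := (stage A P k).side with hn
  let I : Fin d → Finset ℕ := fun a => T.filter fun t => 0 ≤ g a + t ∧ g a + t + n ≤ N
  let emb : (Fin d → ℕ) → (Fin d → ℤ) := fun t => g + fun a => (t a : ℤ)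
  have hinj : Function.Injective emb := fun s t h => by
    funext a
    have := congrFun h a
    simp only [emb, Pi.add_apply] at this
    omega
  have hmem : ∀ t ∈ (Fintype.piFinset I).image emb, ∃ s : Fin d → ℕ, (∀ a, s a ∈ T) ∧
      (∀ a, 0 ≤ g a + s a ∧ g a + s a + n ≤ N) ∧ emb s = t := by
    intro t ht
    obtain ⟨s, hs, rfl⟩ := Finset.mem_image.1 ht
    rw [Fintype.mem_piFinset] at hs
    exact ⟨s, fun a => (Finset.mem_filter.1 (hs a)).1, fun a => (Finset.mem_filter.1 (hs a)).2,
      rfl⟩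
  have hcube : ∀ t ∈ (Fintype.piFinset I).image emb, cube t n ⊆ cube 0 N := by
    intro t ht h hh
    obtain ⟨s, -, h2, rfl⟩ := hmem t ht
    rw [mem_cube] at hh ⊢
    intro a
    have h3 := hh a
    have h4 := h2 a
    simp only [emb, Pi.add_apply] at h3
    simp only [Pi.zero_apply]
    omega
  refine ⟨(Fintype.piFinset I).image emb, fun t ht => ?_, hcube, fun t ht t' ht' htt' => ?_, ?_⟩
  · obtain ⟨s, h1, h2, rfl⟩ := hmem t ht
    refine (hT4 y g hy s h1).congr fun h hh => (hyx h (hcorner h fun a => ?_)).symm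
    have := mem_cube.1 (hcube _ ht hh) a
    simp only [Pi.zero_apply] at this
    omega
  · obtain ⟨s, h1, -, rfl⟩ := hmem t ht
    obtain ⟨s', h1', -, rfl⟩ := hmem t' ht'
    refine Finset.disjoint_left.2 fun h hh hh' => htt' (congrArg emb (funext fun a => ?_))
    have h3 := mem_cube.1 hh a
    have h3' := mem_cube.1 hh' a
    simp only [emb, Pi.add_apply] at h3 h3'
    rcases lt_trichotomy (s a) (s' a) with hlt | heq | hlt
    · have := hT2 _ (h1 a) _ (h1' a) hlt; omega
    · exact heq
    · have := hT2 _ (h1' a) _ (h1 a) hlt; omega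
  · rw [Finset.card_image_of_injective _ hinj, Fintype.card_piFinset]
    have hI : ∀ a, N - 2 * n - 2 ≤ (I a).card * (n + 1) := by
      intro a
      have hcov : Finset.Ico ((n : ℤ) + 1) (N - n - 1) ⊆
          (I a).biUnion fun t => Finset.Ico (g a + t) (g a + t + (n + 1 : ℕ)) := by
        intro b hb
        rw [Finset.mem_Ico] at hb
        have hga := hg a
        obtain ⟨t, ht, h1, h2⟩ := hT3 (b - g a).toNat (by omega)
        refine Finset.mem_biUnion.2 ⟨t, Finset.mem_filter.2 ⟨ht, by omega, by omega⟩, ?_⟩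
        rw [Finset.mem_Ico]
        omega
      have := (Finset.card_le_card hcov).trans Finset.card_biUnion_le
      simp only [Int.card_Ico, add_sub_cancel_left, Int.toNat_natCast, Finset.sum_const,
        smul_eq_mul] at this
      omega
    calc _ = ∏ _a : Fin d, (N - 2 * n - 2) := by simp
      _ ≤ ∏ a, ((I a).card * (n + 1)) := Finset.prod_le_prod' fun a _ => hI a
      _ = _ := by simp [Finset.prod_mul_distrib]

/-- On the subshift, the averages of a local function over a large cube of the lattice `(k!ℤ)^d` are
uniformly close to a constant. -/
lemma eventually_exists_abs_latticeSum_le (hd : 1 ≤ d) (hP : IsSparse P)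
    {f : ((Fin d → ℤ) → A) → ℝ} {l : ℕ} (hf : IsLocal f l) {ε : ℝ} (hε : 0 < ε) :
    ∀ᶠ k : ℕ in atTop, ∃ (c : ℝ) (N : ℕ), 0 < N ∧ k.factorial ∣ N ∧
      ∀ x ∈ (hierarchySubshift A P).carrier,
        |latticeSum k.factorial f x (cube 0 N) - c * ((N / k.factorial : ℕ) : ℝ) ^ d| ≤
          ε * ((N / k.factorial : ℕ) : ℝ) ^ d := by
  classical
  have hε3 : 0 < ε / 3 := by positivity
  obtain ⟨B, hB⟩ := exists_nat_ge (2 * d / (ε / 3))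
  filter_upwards [eventually_abs_latticeSum_block_le (A := A) hd hP hf hε3,
    eventually_ge_atTop B] with k hk hkB
  obtain ⟨c, hc0, hc1, hc⟩ := hk
  have hlarge := (stage_isValid (A := A) hd hP (k + 1)).side_large
  have hfac : k.factorial ≤ (k + 1).factorial := Nat.factorial_le k.le_succ
  set n := (stage A P (k + 1)).side with hn
  set q := k.factorial with hq
  have hq1 : 1 ≤ q := k.factorial_pos
  -- for this `N`, both the gaps and the boundary take up a proportion of order `1 / n`
  set N : ℕ := q * (2 * (n + 1) ^ 2) with hNdef
  have hNn : 2 * (n + 1) ^ 2 ≤ N := Nat.le_mul_of_pos_left _ hq1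
  have hNn' : 2 * n + 2 ≤ N := le_trans (by nlinarith) hNn
  refine ⟨c, N, by positivity, Dvd.intro _ rfl, fun x hx => ?_⟩
  obtain ⟨T, hT1, hT2, hT3, hT4⟩ := exists_disjoint_blocks hd hP hx
    (k := k + 1) (N := N) (by omega)
  rw [← hn] at hT2 hT3 hT4
  have hcast : ((N / q : ℕ) : ℝ) ^ d = (N : ℝ) ^ d / (q : ℝ) ^ d := by
    rw [Nat.cast_div (Dvd.intro _ rfl) (by exact_mod_cast (by omega : q ≠ 0)), div_pow]
  rw [hcast]
  have hmain := hf.abs_latticeSum_sub_le q x hT2 hT3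
  simp only [card_cube, Finset.sum_const, nsmul_eq_mul, Nat.cast_pow] at hmain
  set τ : ℝ := (T.card : ℝ) with hτ
  have hτ0 : 0 ≤ τ := Nat.cast_nonneg _
  have hqR : (1 : ℝ) ≤ q := by exact_mod_cast hq1
  have hqd : 1 ≤ (q : ℝ) ^ d := one_le_pow₀ hqR
  have hNpos : (0 : ℝ) < N := by exact_mod_cast (by omega : 0 < N)
  have hn0 : (0 : ℝ) ≤ n := Nat.cast_nonneg n
  -- the proportion of the points which are not covered is small
  have hτN : τ * (n : ℝ) ^ d ≤ (N : ℝ) ^ d := by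
    have := abs_nonneg (latticeSum q f x (cube 0 N) - ∑ t ∈ T, latticeSum q f x (cube t n))
    linarith
  have hrest : (N : ℝ) ^ d - τ * (n : ℝ) ^ d ≤ ε / 3 * ((N : ℝ) ^ d / (q : ℝ) ^ d) := by
    have h1 : ((N : ℝ) - 2 * n - 2) ^ d ≤ τ * ((n : ℝ) + 1) ^ d := by
      have : ((N - 2 * n - 2 : ℕ) : ℝ) = (N : ℝ) - 2 * n - 2 := by
        rw [Nat.cast_sub (by omega), Nat.cast_sub (by omega)]; push_cast; rfl
      rw [← this, hτ]
      exact_mod_cast hT4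
    have h2 : ((n : ℝ) / (n + 1) * ((N : ℝ) - 2 * n - 2)) ^ d ≤ τ * (n : ℝ) ^ d := by
      rw [mul_pow, div_pow, div_mul_eq_mul_div, div_le_iff₀ (by positivity)]
      calc _ ≤ (n : ℝ) ^ d * (τ * ((n : ℝ) + 1) ^ d) :=
            mul_le_mul_of_nonneg_left h1 (by positivity)
        _ = _ := by ring
    have hNR : 2 * ((n : ℝ) + 1) ^ 2 ≤ N := by exact_mod_cast hNn
    have hn1R : (1 : ℝ) ≤ n := by
      exact_mod_cast (stage_isValid (A := A) hd hP (k + 1)).side_pos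
    have h3 : (N : ℝ) * (1 - 2 / (n + 1)) ≤ (n : ℝ) / (n + 1) * ((N : ℝ) - 2 * n - 2) := by
      have : (n : ℝ) / (n + 1) * ((N : ℝ) - 2 * n - 2) - (N : ℝ) * (1 - 2 / (n + 1)) =
          (N - 2 * n * (n + 1)) / (n + 1) := by
        field_simp; ring
      have h' : 0 ≤ ((N : ℝ) - 2 * n * (n + 1)) / (n + 1) :=
        div_nonneg (by nlinarith) (by positivity)
      linarith
    have h4 : 1 - (d : ℝ) * (2 / (n + 1)) ≤ (1 - 2 / ((n : ℝ) + 1)) ^ d := by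
      have h5 : 2 / ((n : ℝ) + 1) ≤ 1 := by rw [div_le_one (by positivity)]; linarith
      have := one_add_mul_le_pow (a := -(2 / ((n : ℝ) + 1))) (by linarith) d
      rw [← sub_eq_add_neg] at this
      linarith
    have h5 : (N : ℝ) ^ d * (1 - (d : ℝ) * (2 / (n + 1))) ≤ τ * (n : ℝ) ^ d := by
      have h6 : 0 ≤ 1 - 2 / ((n : ℝ) + 1) := by
        rw [sub_nonneg, div_le_one (by positivity)]; linarith
      calc _ ≤ (N : ℝ) ^ d * (1 - 2 / ((n : ℝ) + 1)) ^ d :=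
            mul_le_mul_of_nonneg_left h4 (by positivity)
        _ = ((N : ℝ) * (1 - 2 / ((n : ℝ) + 1))) ^ d := (mul_pow _ _ _).symm
        _ ≤ _ := (pow_le_pow_left₀ (mul_nonneg hNpos.le h6) h3 d).trans h2
    have h6 : (d : ℝ) * (2 / (n + 1)) ≤ ε / 3 / (q : ℝ) ^ d := by
      rw [← mul_div_assoc, div_le_div_iff₀ (by positivity) (by positivity)]
      have h7 : 2 * d / (ε / 3) ≤ k := hB.trans (by exact_mod_cast hkB)
      rw [div_le_iff₀ hε3] at h7
      have h8 : (k : ℝ) * (q : ℝ) ^ d ≤ n := by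
        have : k * q ^ d ≤ n :=
          (Nat.mul_le_mul (Nat.le_succ k) (Nat.pow_le_pow_left hfac d)).trans hlarge
        exact_mod_cast this
      have h9 : ε / 3 * ((k : ℝ) * (q : ℝ) ^ d) ≤ ε / 3 * n := by gcongr
      have h7' := mul_le_mul_of_nonneg_right h7 (zero_le_one.trans hqd)
      calc (d : ℝ) * 2 * (q : ℝ) ^ d = 2 * d * (q : ℝ) ^ d := by ring
        _ ≤ _ := h7'
        _ = ε / 3 * ((k : ℝ) * (q : ℝ) ^ d) := by ring
        _ ≤ ε / 3 * n := h9
        _ ≤ ε / 3 * (n + 1) := by gcongr; linarith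
    have h10 := mul_le_mul_of_nonneg_left h6 (show 0 ≤ (N : ℝ) ^ d by positivity)
    have h11 : (N : ℝ) ^ d * (ε / 3 / (q : ℝ) ^ d) = ε / 3 * ((N : ℝ) ^ d / (q : ℝ) ^ d) := by ring
    rw [h11] at h10
    linarith
  have hblocks : |∑ t ∈ T, latticeSum q f x (cube t n) - τ * (c * ((n : ℝ) ^ d / (q : ℝ) ^ d))| ≤
      ε / 3 * ((N : ℝ) ^ d / (q : ℝ) ^ d) := by
    have h1 : ∑ t ∈ T, latticeSum q f x (cube t n) - τ * (c * ((n : ℝ) ^ d / (q : ℝ) ^ d)) =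
        ∑ t ∈ T, (latticeSum q f x (cube t n) - c * ((n : ℝ) ^ d / (q : ℝ) ^ d)) := by
      rw [Finset.sum_sub_distrib, Finset.sum_const, nsmul_eq_mul]
    rw [h1]
    refine (Finset.abs_sum_le_sum_abs _ _).trans
      ((Finset.sum_le_sum fun t ht => hc x t (hT1 t ht)).trans ?_)
    rw [Finset.sum_const, nsmul_eq_mul]
    calc _ = ε / 3 * (τ * (n : ℝ) ^ d / (q : ℝ) ^ d) := by ring
      _ ≤ _ := by gcongr
  have hconst : |τ * (c * ((n : ℝ) ^ d / (q : ℝ) ^ d)) - c * ((N : ℝ) ^ d / (q : ℝ) ^ d)| ≤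
      ε / 3 * ((N : ℝ) ^ d / (q : ℝ) ^ d) := by
    have h1 : τ * (c * ((n : ℝ) ^ d / (q : ℝ) ^ d)) - c * ((N : ℝ) ^ d / (q : ℝ) ^ d) =
        -(c * (((N : ℝ) ^ d - τ * (n : ℝ) ^ d) / (q : ℝ) ^ d)) := by ring
    have h2 : 0 ≤ (N : ℝ) ^ d - τ * (n : ℝ) ^ d := by linarith
    rw [h1, abs_neg, abs_of_nonneg (by positivity)]
    calc _ ≤ 1 * (((N : ℝ) ^ d - τ * (n : ℝ) ^ d) / 1) := by gcongr
      _ ≤ _ := by rw [one_mul, div_one]; exact hrest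
  have hfirst := hmain.trans hrest
  rw [abs_le] at hfirst hblocks hconst ⊢
  constructor <;> linarith [hfirst.1, hfirst.2, hblocks.1, hblocks.2, hconst.1, hconst.2]

end

/-! ### Invariant measures -/

section
variable {d : ℕ} {A : Type*} [TopologicalSpace A]

lemma coe_vadd_apply (X : Subshift A (Fin d → ℤ)) (g : Fin d → ℤ) (x : X.carrier)
    (h : Fin d → ℤ) : (g +ᵥ x).1 h = x.1 (g + h) := rfl

lemma continuous_vadd (X : Subshift A (Fin d → ℤ)) (g : Fin d → ℤ) :
    Continuous fun x : X.carrier => g +ᵥ x :=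
  continuous_induced_rng.2 (continuous_pi fun h =>
    (continuous_apply (g + h)).comp continuous_subtype_val)

/-- Translating a large cube changes few of its points. -/
lemma tendsto_card_sdiff_div (v : Fin d → ℤ) :
    Tendsto (fun n : ℕ => ((cube (0 : Fin d → ℤ) n \ cube v n).card : ℝ) / (n : ℝ) ^ d) atTop
        (𝓝 0) ∧
      Tendsto (fun n : ℕ => ((cube v n \ cube (0 : Fin d → ℤ) n).card : ℝ) / (n : ℝ) ^ d) atTop
        (𝓝 0) := by
  classical
  set m : ℕ := ∑ a, (v a).natAbs with hm
  have hva : ∀ a, (v a).natAbs ≤ m := fun a =>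
    Finset.single_le_sum (f := fun a => (v a).natAbs) (fun _ _ => Nat.zero_le _)
      (Finset.mem_univ a)
  have hbound : ∀ n, m ≤ n → 1 ≤ n → ∀ s t : Finset (Fin d → ℤ), s.card = n ^ d →
      cube (fun a => max (v a) 0) (n - m) ⊆ t → cube (fun a => max (v a) 0) (n - m) ⊆ s →
      ((s \ t).card : ℝ) / (n : ℝ) ^ d ≤ 1 - (1 - m / n) ^ d := by
    intro n hmn hn s t hs ht hs'
    have hn0 : (0 : ℝ) < n := by exact_mod_cast hn
    have h1 : ((s \ t).card : ℝ) ≤ (n : ℝ) ^ d - ((n : ℝ) - m) ^ d := by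
      have h2 : (s \ t).card ≤ (s \ cube (fun a => max (v a) 0) (n - m)).card :=
        Finset.card_le_card (Finset.sdiff_subset_sdiff le_rfl ht)
      have h3 : ((s \ cube (fun a => max (v a) 0) (n - m)).card : ℝ) =
          (n : ℝ) ^ d - ((n : ℝ) - m) ^ d := by
        rw [Finset.cast_card_sdiff hs', hs, card_cube, Nat.cast_pow, Nat.cast_pow,
          Nat.cast_sub hmn]
      rw [← h3]; exact_mod_cast h2
    rw [div_le_iff₀ (by positivity), sub_mul, ← mul_pow, sub_mul, div_mul_cancel₀ _ hn0.ne',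
      one_mul, one_mul]
    exact h1
  have hlim : Tendsto (fun n : ℕ => 1 - (1 - (m : ℝ) / n) ^ d) atTop (𝓝 0) := by
    have := (((tendsto_const_div_atTop_nhds_zero_nat (m : ℝ)).const_sub 1).pow d).const_sub 1
    simpa using this
  have hsub0 : ∀ n, m ≤ n → cube (fun a => max (v a) 0) (n - m) ⊆ cube (0 : Fin d → ℤ) n := by
    intro n hmn h hh
    rw [mem_cube] at hh ⊢
    intro a
    have h1 := hh a
    have h2 := hva a
    simp only [Pi.zero_apply]
    omega
  have hsubv : ∀ n, m ≤ n → cube (fun a => max (v a) 0) (n - m) ⊆ cube v n := by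
    intro n hmn h hh
    rw [mem_cube] at hh ⊢
    intro a
    have h1 := hh a
    have h2 := hva a
    omega
  constructor
  · refine tendsto_of_tendsto_of_tendsto_of_le_of_le' tendsto_const_nhds hlim
      (Eventually.of_forall fun n => by positivity) ?_
    filter_upwards [eventually_ge_atTop m, eventually_ge_atTop 1] with n h1 h2
    exact hbound n h1 h2 _ _ (card_cube _ _) (hsubv n h1) (hsub0 n h1)
  · refine tendsto_of_tendsto_of_tendsto_of_le_of_le' tendsto_const_nhds hlim
      (Eventually.of_forall fun n => by positivity) ?_
    filter_upwards [eventually_ge_atTop m, eventually_ge_atTop 1] with n h1 h2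
    exact hbound n h1 h2 _ _ (card_cube _ _) (hsub0 n h1) (hsubv n h1)

lemma norm_sum_cube_add_sub_le (φ : (Fin d → ℤ) → ℝ) {C : ℝ} (hφ : ∀ h, ‖φ h‖ ≤ C)
    (v : Fin d → ℤ) (n : ℕ) :
    ‖∑ h ∈ cube (0 : Fin d → ℤ) n, φ (v + h) - ∑ h ∈ cube (0 : Fin d → ℤ) n, φ h‖ ≤
      (((cube (0 : Fin d → ℤ) n \ cube v n).card : ℝ) +
        ((cube v n \ cube (0 : Fin d → ℤ) n).card : ℝ)) * C := by
  classical
  have h3 : ∑ h ∈ cube (0 : Fin d → ℤ) n, φ (v + h) = ∑ h ∈ cube v n, φ h := by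
    refine Finset.sum_bij (fun h _ => v + h) (fun h hh => ?_) (fun h _ h' _ e => add_left_cancel e)
      (fun h hh => ⟨h - v, ?_, add_sub_cancel _ _⟩) fun h _ => rfl
    · have := (add_mem_cube (g := v)).2 hh
      rwa [add_zero] at this
    · have : v + (h - v) ∈ cube (v + 0) n := by rwa [add_zero, add_sub_cancel]
      exact add_mem_cube.1 this
  have hb : ∀ s : Finset (Fin d → ℤ), ‖∑ h ∈ s, φ h‖ ≤ s.card * C := fun s => by
    refine (norm_sum_le _ _).trans ((Finset.sum_le_sum fun h _ => hφ h).trans ?_)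
    rw [Finset.sum_const, nsmul_eq_mul]
  rw [h3, ← Finset.sum_sdiff_sub_sum_sdiff, add_mul, add_comm (_ * C)]
  exact (norm_sub_le _ _).trans (add_le_add (hb _) (hb _))

variable [MeasurableSpace A]

/-- The uniform distribution on a cubical piece of the orbit of `x`. -/
def empiricalMeasure {X : Subshift A (Fin d → ℤ)} (x : X.carrier) (n : ℕ) :
    Measure X.carrier :=
  ((n : ENNReal) ^ d)⁻¹ • ∑ h ∈ cube (0 : Fin d → ℤ) n, Measure.dirac (h +ᵥ x)

lemma isProbabilityMeasure_empiricalMeasure {X : Subshift A (Fin d → ℤ)} (x : X.carrier) {n : ℕ}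
    (hn : 0 < n) : IsProbabilityMeasure (empiricalMeasure x n) := by
  refine ⟨?_⟩
  simp only [empiricalMeasure, Measure.smul_apply, Measure.finsetSum_apply, measure_univ,
    Finset.sum_const, card_cube, nsmul_eq_mul, smul_eq_mul, mul_one, Nat.cast_pow]
  refine ENNReal.inv_mul_cancel ?_ (by simp)
  exact pow_ne_zero _ (by exact_mod_cast hn.ne')

variable [Fintype A] [DiscreteTopology A] [BorelSpace A]

lemma integral_empiricalMeasure {X : Subshift A (Fin d → ℤ)} (x : X.carrier) (n : ℕ)
    (f : BoundedContinuousFunction X.carrier ℝ) :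
    ∫ y, f y ∂empiricalMeasure x n =
      (∑ h ∈ cube (0 : Fin d → ℤ) n, f (h +ᵥ x)) / (n : ℝ) ^ d := by
  rw [empiricalMeasure, integral_smul_measure, integral_finsetSum_measure]
  · simp [integral_dirac, div_eq_inv_mul]
  · exact fun h _ => f.integrable _

/-- The Krylov–Bogoliubov theorem for the shift action. -/
lemma exists_invariant_measure (X : Subshift A (Fin d → ℤ)) (hX : X.carrier.Nonempty) :
    ∃ μ : Measure X.carrier, IsProbabilityMeasure μ ∧
      VAddInvariantMeasure (Fin d → ℤ) X.carrier μ := by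
  classical
  obtain ⟨x₀, hx₀⟩ := hX
  let x : X.carrier := ⟨x₀, hx₀⟩
  have : CompactSpace X.carrier := isCompact_iff_compactSpace.1 X.isClosed.isCompact
  let μs : ℕ → ProbabilityMeasure X.carrier := fun n =>
    ⟨empiricalMeasure x (n + 1), isProbabilityMeasure_empiricalMeasure x n.succ_pos⟩
  let U : Ultrafilter ℕ := hyperfilter ℕ
  have hU : (U : Filter ℕ) ≤ atTop := Nat.hyperfilter_le_atTop
  obtain ⟨μ, -, hμ⟩ := isCompact_univ.ultrafilter_le_nhds (U.map μs) (by simp)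
  have hμ : Tendsto μs U (𝓝 μ) := hμ
  rw [ProbabilityMeasure.tendsto_iff_forall_integral_tendsto] at hμ
  refine ⟨μ, inferInstance, ⟨fun v s hs => ?_⟩⟩
  have hmeas : Measurable fun y : X.carrier => v +ᵥ y := (continuous_vadd X v).measurable
  have hprob : IsProbabilityMeasure ((μ : Measure X.carrier).map fun y => v +ᵥ y) :=
    Measure.isProbabilityMeasure_map hmeas.aemeasurable
  suffices h : (μ : Measure X.carrier).map (fun y => v +ᵥ y) = μ by
    rw [← Measure.map_apply hmeas hs, h]
  refine ext_of_forall_integral_eq_of_IsFiniteMeasure fun f => ?_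
  rw [integral_map hmeas.aemeasurable f.continuous.aestronglyMeasurable]
  let fv : BoundedContinuousFunction X.carrier ℝ := f.compContinuous ⟨_, continuous_vadd X v⟩
  have h1 := hμ f
  have h2 := hμ fv
  refine tendsto_nhds_unique h2 ?_
  -- `fv` is the translate of `f`; its averages differ from those of `f` by a boundary term
  have hdiff : Tendsto (fun n => ∫ y, fv y ∂(μs n : Measure X.carrier) -
      ∫ y, f y ∂(μs n : Measure X.carrier)) U (𝓝 0) := by
    have hlim := ((((tendsto_card_sdiff_div v).1.add (tendsto_card_sdiff_div v).2).mul_const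
      ‖f‖).comp (tendsto_add_atTop_nat 1)).mono_left hU
    rw [add_zero, zero_mul] at hlim
    refine squeeze_zero_norm (fun n => ?_) hlim
    change ‖∫ y, fv y ∂empiricalMeasure x (n + 1) - ∫ y, f y ∂empiricalMeasure x (n + 1)‖ ≤ _
    rw [integral_empiricalMeasure, integral_empiricalMeasure]
    simp only [Function.comp_apply]
    rw [← sub_div, norm_div, ← add_div, div_mul_eq_mul_div,
      Real.norm_of_nonneg (by positivity : (0 : ℝ) ≤ ((n + 1 : ℕ) : ℝ) ^ d)]
    refine div_le_div_of_nonneg_right ?_ (by positivity)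
    have h3 : ∀ h : Fin d → ℤ, fv (h +ᵥ x) = f ((v + h) +ᵥ x) := fun h =>
      congrArg f (vadd_vadd v h x)
    simp_rw [h3]
    exact norm_sum_cube_add_sub_le (fun h => f (h +ᵥ x)) (fun h => f.norm_coe_le_norm _) v (n + 1)
  have := h1.add hdiff
  simpa using this

end

lemma factorial_nsmul_mem {G : Type*} [AddCommGroup G] (F : AddSubgroup G) [F.FiniteIndex] {k : ℕ}
    (hk : F.index ≤ k) (g : G) : k.factorial • g ∈ F := by
  obtain ⟨m, hm⟩ := Nat.dvd_factorial (Nat.pos_of_ne_zero F.index_ne_zero_of_finite) hk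
  rw [hm, mul_nsmul]
  exact F.nsmul_mem (F.nsmul_index_mem g) m

/-- A subgroup of finite index contains the lattice `(k!ℤ)^d` for large `k`. -/
lemma mem_of_residue_eq_zero {d : ℕ} (F : AddSubgroup (Fin d → ℤ)) [F.FiniteIndex] {k : ℕ}
    (hk : F.index ≤ k) {g : Fin d → ℤ} (hg : residue k.factorial g = 0) : g ∈ F := by
  have h : ∀ a, ∃ b, g a = k.factorial * b := fun a => by
    have := congrFun hg a
    simp only [residue, Pi.zero_apply] at this
    exact (ZMod.intCast_zmod_eq_zero_iff_dvd _ _).1 this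
  choose b hb using h
  have : g = k.factorial • b := by
    funext a; rw [hb a]; simp
  rw [this]
  exact factorial_nsmul_mem F hk b

/-- If the lattice averages of the indicator of `S` are uniformly close to `c`, then so is the
measure of `S` for every invariant measure, since it is the integral of these averages. -/
lemma abs_measureReal_sub_le {d : ℕ} {A : Type*} [Fintype A] [TopologicalSpace A]
    [DiscreteTopology A] [MeasurableSpace A] [BorelSpace A] {X : Subshift A (Fin d → ℤ)}
    {F : AddSubgroup (Fin d → ℤ)} [F.FiniteIndex] {μ : Measure X.carrier} [IsProbabilityMeasure μ]
    [VAddInvariantMeasure F X.carrier μ] {k N : ℕ} (hk : F.index ≤ k) (hN0 : 0 < N)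
    (hN : k.factorial ∣ N) {S : Set ((Fin d → ℤ) → A)} (hS : MeasurableSet S) {c ε : ℝ}
    (h : ∀ x ∈ X.carrier, |latticeSum k.factorial (S.indicator fun _ => 1) x (cube 0 N) -
      c * ((N / k.factorial : ℕ) : ℝ) ^ d| ≤ ε * ((N / k.factorial : ℕ) : ℝ) ^ d) :
    |μ.real (Subtype.val ⁻¹' S) - c| ≤ ε := by
  classical
  have : NeZero k.factorial := ⟨k.factorial_ne_zero⟩
  set E := (cube (0 : Fin d → ℤ) N).filter fun h => residue k.factorial h = 0 with hE
  have hEcard : (E.card : ℝ) = ((N / k.factorial : ℕ) : ℝ) ^ d := by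
    rw [hE, card_filter_cube_residue_eq hN]; push_cast; rfl
  have hEpos : (0 : ℝ) < E.card := by
    rw [hEcard]
    have : 0 < N / k.factorial := Nat.div_pos (Nat.le_of_dvd hN0 hN) k.factorial_pos
    positivity
  rw [← hEcard] at h
  have hmeas : ∀ g : Fin d → ℤ, MeasurableSet ((fun x : X.carrier => g +ᵥ x) ⁻¹'
      (Subtype.val ⁻¹' S)) := fun g =>
    (continuous_vadd X g).measurable (measurable_subtype_coe hS)
  have hinv : ∀ g ∈ E, μ.real ((fun x : X.carrier => g +ᵥ x) ⁻¹' (Subtype.val ⁻¹' S)) =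
      μ.real (Subtype.val ⁻¹' S) := by
    intro g hg
    have hgF : g ∈ F := mem_of_residue_eq_zero F hk (Finset.mem_filter.1 hg).2
    exact congrArg ENNReal.toReal (VAddInvariantMeasure.measure_preimage_vadd (μ := μ)
      (⟨g, hgF⟩ : F) (measurable_subtype_coe hS))
  let Λ : X.carrier → ℝ := fun x => ∑ g ∈ E,
    ((fun x : X.carrier => g +ᵥ x) ⁻¹' (Subtype.val ⁻¹' S)).indicator (fun _ => (1 : ℝ)) x
  have hterm : ∀ g ∈ E, Integrable (((fun x : X.carrier => g +ᵥ x) ⁻¹'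
      (Subtype.val ⁻¹' S)).indicator fun _ => (1 : ℝ)) μ := fun g _ =>
    (integrable_const 1).indicator (hmeas g)
  have hint : ∫ x, Λ x ∂μ = E.card * μ.real (Subtype.val ⁻¹' S) := by
    simp only [Λ]
    rw [integral_finsetSum _ hterm]
    rw [Finset.sum_congr rfl fun g hg => (integral_indicator_const 1 (hmeas g)).trans
      (by rw [hinv g hg])]
    simp
  have hdiff : |∫ x, (Λ x - c * E.card) ∂μ| ≤ ε * E.card := by
    have := norm_integral_le_of_norm_le_const (μ := μ) (C := ε * E.card)
      (f := fun x => Λ x - c * E.card) (Eventually.of_forall fun x : X.carrier => h x.1 x.2)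
    simpa using this
  rw [integral_sub (integrable_finsetSum _ hterm) (integrable_const _), hint, integral_const,
    probReal_univ, one_smul, mul_comm c, ← mul_sub, abs_mul, abs_of_pos hEpos, mul_comm ε] at hdiff
  exact le_of_mul_le_mul_left hdiff hEpos

section
variable {d : ℕ} {A : Type*} [Fintype A] [Nonempty A] {P : Set (Fin d → ℤ)}
  [TopologicalSpace A] [DiscreteTopology A]

/-- The action of every subgroup of finite index is minimal: a block of stage `k + 1` contains all
blocks of stage `k`, at positions with all residues modulo `k!`. -/
lemma isMinimal_hierarchySubshift (hd : 1 ≤ d) (hP : IsSparse P) (F : AddSubgroup (Fin d → ℤ))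
    [F.FiniteIndex] : AddAction.IsMinimal F (hierarchySubshift A P).carrier := by
  classical
  refine ⟨fun x => dense_iff_inter_open.2 fun U hU hne => ?_⟩
  obtain ⟨y, hyU⟩ := hne
  obtain ⟨V, hV, hVU⟩ := mem_nhds_induced Subtype.val y U |>.1 (hU.mem_nhds hyU)
  obtain ⟨N, hN⟩ := exists_window_subset_of_mem_nhds hV
  have hmono := side_strictMono (A := A) hd hP
  set N' := max N (stage A P F.index).side with hN'
  obtain ⟨k, g, y', hy', hsub, hyy⟩ := y.2 N'
  have hwin : window d N ⊆ window d N' := fun h hh => mem_window.2 fun a => by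
    have := mem_window.1 hh a
    have : N ≤ N' := le_max_left _ _
    omega
  have hk : F.index ≤ k := by
    rw [← hmono.le_iff_le]
    have h1 := mem_cube.1 (hsub (mem_window.2 (fun a => ⟨le_rfl, by omega⟩) :
      (fun _ => -(N' : ℤ)) ∈ window d N')) ⟨0, hd⟩
    have h2 := mem_cube.1 (hsub (mem_window.2 (fun a => ⟨by omega, le_rfl⟩) :
      (fun _ => (N' : ℤ)) ∈ window d N')) ⟨0, hd⟩
    have : (stage A P F.index).side ≤ N' := le_max_right _ _
    omega
  obtain ⟨T, hT1, -, -, hT4⟩ := exists_disjoint_blocks hd hP x.2 (k := k + 1)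
    (N := 2 * (stage A P (k + 1)).side + 3) (by omega)
  have hTne : T.Nonempty := by
    rw [Finset.nonempty_iff_ne_empty]
    rintro rfl
    have h1 : 2 * (stage A P (k + 1)).side + 3 - 2 * (stage A P (k + 1)).side - 2 = 1 := by omega
    rw [h1, one_pow] at hT4
    simp at hT4
  obtain ⟨t, ht⟩ := hTne
  have hblock := hT1 t ht
  obtain ⟨-, hbal⟩ := Stage.isBlock_next.1 hblock
  have hL := admissible_scale (A := A) hd hP k
  have : NeZero k.factorial := ⟨k.factorial_ne_zero⟩
  have hM : (0 : ℝ) < classSize d (scale P (stage A P k) k) k.factorial := by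
    exact_mod_cast hL.classSize_pos
  obtain ⟨j, hj1, hj2⟩ : ∃ j, residue k.factorial (slotPos (stage A P k).side _ j) =
      residue k.factorial (g - t) ∧
      pattern (stage A P k).side x.1 (t + slotPos (stage A P k).side _ j) =
        pattern (stage A P k).side y' g := by
    refine hbal.exists_eq ?_ hM (residue k.factorial (g - t)) hy'
    rw [tolerance, div_lt_one (by positivity)]
    have : (0 : ℝ) ≤ k := Nat.cast_nonneg k
    linarith
  set v := t + slotPos (stage A P k).side _ j - g with hv
  have hvF : v ∈ F := by
    refine mem_of_residue_eq_zero F hk ?_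
    have h1 : v = slotPos (stage A P k).side _ j - (g - t) := by rw [hv]; abel
    have h2 := residue_add k.factorial v (g - t)
    rw [h1, sub_add_cancel, hj1] at h2
    rw [h1]
    simpa using h2
  refine ⟨(⟨v, hvF⟩ : F) +ᵥ x, hVU (hN _ fun h hh => ?_), ⟨_, rfl⟩⟩
  change x.1 (v + h) = y.1 h
  rw [← hyy h (hwin hh)]
  have h1 := pattern_eq_iff.1 hj2 (h - g) (by
    have := hsub (hwin hh)
    rw [mem_cube] at this ⊢
    intro a
    have := this a
    simp only [Pi.zero_apply, Pi.sub_apply]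
    omega)
  have h2 : t + slotPos (stage A P k).side _ j + (h - g) = v + h := by rw [hv]; abel
  rw [h2, add_sub_cancel] at h1
  exact h1

variable [MeasurableSpace A] [BorelSpace A]

/-- The action of a subgroup of finite index has at most one invariant measure: the measures of
cylinders are limits of the constants to which the lattice averages are uniformly close. -/
lemma invariant_measure_unique (hd : 1 ≤ d) (hP : IsSparse P) (F : AddSubgroup (Fin d → ℤ))
    [F.FiniteIndex] (μ ν : Measure (hierarchySubshift A P).carrier) [IsProbabilityMeasure μ]
    [IsProbabilityMeasure ν] [VAddInvariantMeasure F (hierarchySubshift A P).carrier μ]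
    [VAddInvariantMeasure F (hierarchySubshift A P).carrier ν] : μ = ν := by
  classical
  have hval : MeasurableEmbedding (Subtype.val : (hierarchySubshift A P).carrier → _) :=
    MeasurableEmbedding.subtype_coe (hierarchySubshift A P).isClosed.measurableSet
  have hmapμ : IsProbabilityMeasure (μ.map Subtype.val) :=
    Measure.isProbabilityMeasure_map measurable_subtype_coe.aemeasurable
  have hmapν : IsProbabilityMeasure (ν.map Subtype.val) :=
    Measure.isProbabilityMeasure_map measurable_subtype_coe.aemeasurable
  have hmap : μ.map Subtype.val = ν.map Subtype.val := by
    refine ext_of_generate_finite _ generateFrom_measurableCylinders.symm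
      isPiSystem_measurableCylinders (fun S hS => ?_) (by simp)
    have hSm : MeasurableSet S := MeasurableSet.of_mem_measurableCylinders hS
    rw [Measure.map_apply measurable_subtype_coe hSm, Measure.map_apply measurable_subtype_coe hSm]
    obtain ⟨s, S', -, rfl⟩ := (mem_measurableCylinders S).1 hS
    obtain ⟨l, hl⟩ := exists_subset_window s
    have hloc : IsLocal ((cylinder s S').indicator fun _ => (1 : ℝ)) l := by
      refine ⟨fun x => Set.indicator_nonneg (fun _ _ => zero_le_one) x,
        fun x => Set.indicator_le_self' (fun _ _ => zero_le_one) x, fun x y hxy => ?_⟩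
      have hr : s.restrict x = s.restrict y := by
        funext h; exact hxy h (hl h.2)
      have : x ∈ cylinder s S' ↔ y ∈ cylinder s S' := by
        simp only [mem_cylinder, hr]
      by_cases hx : x ∈ cylinder s S'
      · rw [Set.indicator_of_mem hx, Set.indicator_of_mem (this.1 hx)]
      · rw [Set.indicator_of_notMem hx, Set.indicator_of_notMem (fun h => hx (this.2 h))]
    rw [← measureReal_eq_measureReal_iff]
    refine eq_of_abs_sub_le_all fun ε hε => ?_
    obtain ⟨k, ⟨c, N, hN0, hN, hc⟩, hk⟩ := ((eventually_exists_abs_latticeSum_le (A := A) hd hP hloc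
      (half_pos hε)).and (eventually_ge_atTop F.index)).exists
    have h1 := abs_measureReal_sub_le (μ := μ) (F := F) hk hN0 hN hSm hc
    have h2 := abs_measureReal_sub_le (μ := ν) (F := F) hk hN0 hN hSm hc
    rw [abs_le] at h1 h2 ⊢
    constructor <;> linarith [h1.1, h1.2, h2.1, h2.2]
  exact hval.map_injective hmap

lemma isTotallyStrictlyErgodic_hierarchySubshift (hd : 1 ≤ d) (hP : IsSparse P) :
    IsTotallyStrictlyErgodic (Fin d → ℤ) (hierarchySubshift A P).carrier := by
  intro F hF
  refine ⟨isMinimal_hierarchySubshift hd hP F, ?_⟩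
  obtain ⟨μ, hμ1, hμ2⟩ := exists_invariant_measure (hierarchySubshift A P)
    (hierarchySubshift_nonempty hd hP)
  have hμF : VAddInvariantMeasure F (hierarchySubshift A P).carrier μ :=
    ⟨fun c s hs => hμ2.measure_preimage_vadd (c : Fin d → ℤ) hs⟩
  refine ⟨μ, ⟨hμ1, hμF⟩, ?_⟩
  rintro ν ⟨hν1, hνF⟩
  exact invariant_measure_unique hd hP F ν μ

end

/-! ### Oscillating averages along `P` -/

/-- Zero upper Banach density, restricted to cubes. -/
lemma isSparse_of_upperBanachDensity_eq_zero {d : ℕ} {P : Set (Fin d → ℤ)}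
    (hP : upperBanachDensity P = 0) : IsSparse P := by
  classical
  intro δ hδ
  have hle : ∀ (n : Fin d → ℕ) (r : Fin d → ℤ),
      (((latticeBox r n).filter (· ∈ P)).card : ℝ) / ∏ i, (n i : ℝ) ≤ 1 := by
    intro n r
    refine div_le_one_of_le₀ ?_ (Finset.prod_nonneg fun i _ => Nat.cast_nonneg _)
    have h := Finset.card_filter_le (latticeBox r n) (· ∈ P)
    have h2 : (latticeBox r n).card = ∏ i, n i := by simp [latticeBox, Fintype.card_piFinset]
    rw [h2] at h
    exact_mod_cast h
  have hbdd : ∀ n : Fin d → ℕ, BddAbove (Set.range fun r : Fin d → ℤ =>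
      (((latticeBox r n).filter (· ∈ P)).card : ℝ) / ∏ i, (n i : ℝ)) := fun n =>
    ⟨1, by rintro _ ⟨r, rfl⟩; exact hle n r⟩
  have hev := eventually_lt_of_limsup_lt (show limsup (fun n : Fin d → ℕ => ⨆ r : Fin d → ℤ,
      (((latticeBox r n).filter (· ∈ P)).card : ℝ) / ∏ i, (n i : ℝ)) atTop < δ by
        convert hδ; unfold upperBanachDensity at hP; convert hP)
    (isBoundedUnder_of ⟨1, fun n => ciSup_le (hle n)⟩)
  obtain ⟨n₀, hn₀⟩ := eventually_atTop.1 hev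
  refine ⟨1 + ∑ i, n₀ i, fun n hn g => ?_⟩
  have h1 := hn₀ (fun _ => n) fun i => (Finset.single_le_sum (f := n₀)
    (fun _ _ => Nat.zero_le _) (Finset.mem_univ i)).trans (show ∑ i, n₀ i ≤ n by omega)
  have h2 := (le_ciSup (hbdd fun _ => n) g).trans h1.le
  have hn0 : (0 : ℝ) < n := by exact_mod_cast (by omega : 0 < n)
  rw [Finset.prod_const, Finset.card_univ, Fintype.card_fin, div_le_iff₀ (by positivity)] at h2
  exact h2

lemma tendsto_card_centralPart {d : ℕ} {P : Set (Fin d → ℤ)} (hP : P.Infinite) :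
    Tendsto (fun n => ((centralPart P n).card : ℝ)) atTop atTop := by
  classical
  refine tendsto_natCast_atTop_atTop.comp ?_
  refine tendsto_atTop.2 fun b => ?_
  obtain ⟨t, htP, ht⟩ := hP.exists_subset_card_eq b
  obtain ⟨N, hN⟩ := exists_subset_window t
  filter_upwards [eventually_gt_atTop N] with n hn
  rw [← ht]
  refine Finset.card_le_card fun h hh => ?_
  simp only [centralPart, Finset.mem_filter, Fintype.mem_piFinset, Finset.mem_Ioo]
  refine ⟨fun a => ?_, htP hh⟩
  have := mem_window.1 (hN hh) a
  omega

section
variable {d : ℕ} {P : Set (Fin d → ℤ)} {C : Finset ℝ}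

lemma averageAlong_mem_Icc {X : Subshift C (Fin d → ℤ)} (hC : (C : Set ℝ) ⊆ Set.Icc 0 1)
    {f : X.carrier → ℝ} (hf : ∀ x, f x = (x.1 0 : ℝ)) (n : ℕ) (x : X.carrier) :
    averageAlong P f n x ∈ Set.Icc 0 1 := by
  have h01 : ∀ y, f y ∈ Set.Icc (0 : ℝ) 1 := fun y => by rw [hf]; exact hC (y.1 0).2
  refine ⟨div_nonneg (Finset.sum_nonneg fun g _ => (h01 _).1) (Nat.cast_nonneg _),
    div_le_one_of_le₀ ?_ (Nat.cast_nonneg _)⟩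
  refine (Finset.sum_le_card_nsmul _ _ 1 fun g _ => (h01 _).2).trans ?_
  rw [nsmul_one]

/-- If the symbols on `P` are `z` up to a finite set, then the averages converge to `z`. -/
lemma tendsto_averageAlong {X : Subshift C (Fin d → ℤ)} (hinf : P.Infinite)
    {f : X.carrier → ℝ} (hf : ∀ x, f x = (x.1 0 : ℝ)) {x : X.carrier} {z : C}
    {D : Finset (Fin d → ℤ)} (hx : ∀ h ∈ P, h ∉ D → x.1 h = z) :
    Tendsto (fun n => averageAlong P f n x) atTop (𝓝 (z : ℝ)) := by
  classical
  have hval : ∀ g : Fin d → ℤ, f (g +ᵥ x) = (x.1 g : ℝ) := fun g => by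
    rw [hf, coe_vadd_apply, add_zero]
  set B : ℝ := ∑ h ∈ D, |(x.1 h : ℝ) - z| with hB
  have hcard := tendsto_card_centralPart hinf
  rw [tendsto_iff_norm_sub_tendsto_zero]
  refine squeeze_zero' (Eventually.of_forall fun n => norm_nonneg _) ?_
    (hcard.const_div_atTop B)
  filter_upwards [hcard.eventually_gt_atTop 0] with n hn
  have h1 : averageAlong P f n x - z =
      (∑ g ∈ centralPart P n, ((x.1 g : ℝ) - z)) / ((centralPart P n).card : ℝ) := by
    rw [averageAlong, Finset.sum_sub_distrib, Finset.sum_const, nsmul_eq_mul, sub_div,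
      mul_div_cancel_left₀ _ hn.ne']
    simp_rw [hval]
  rw [h1, norm_div, Real.norm_of_nonneg hn.le]
  refine div_le_div_of_nonneg_right ?_ hn.le
  refine (norm_sum_le _ _).trans ?_
  calc ∑ g ∈ centralPart P n, ‖(x.1 g : ℝ) - z‖
      = ∑ g ∈ centralPart P n ∩ D, ‖(x.1 g : ℝ) - z‖ := by
        symm
        refine Finset.sum_subset Finset.inter_subset_left fun g hg hgD => ?_
        have hgP : g ∈ P := by
          simp only [centralPart, Finset.mem_filter] at hg
          exact hg.2
        have hgD' : g ∉ D := fun h => hgD (Finset.mem_inter.2 ⟨hg, h⟩)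
        rw [hx g hgP hgD', sub_self, norm_zero]
    _ ≤ B := Finset.sum_le_sum_of_subset_of_nonneg Finset.inter_subset_right
        fun _ _ _ => norm_nonneg _

/-- For a residual set of points, the averages along `P` come infinitely often close to a given
value `z`, provided that the symbols on `P` may be chosen to be `z` up to finite sets. -/
lemma eventually_residual_frequently {X : Subshift C (Fin d → ℤ)} (hinf : P.Infinite)
    {f : C(X.carrier, ℝ)} (hf : ∀ x, f x = (x.1 0 : ℝ)) (z : C)
    (hX : ∀ x ∈ X.carrier, ∀ N, ∃ y ∈ X.carrier, (∀ h ∈ window d N, y h = x h) ∧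
      ∃ D : Finset (Fin d → ℤ), ∀ h ∈ P, h ∉ D → y h = z) :
    ∀ᶠ x in residual X.carrier, ∀ ε : ℝ, 0 < ε →
      ∃ᶠ n in atTop, |averageAlong P f n x - z| < ε := by
  have hcont : ∀ n, Continuous fun x : X.carrier => averageAlong P f n x := fun n =>
    (continuous_finsetSum _ fun g _ => f.continuous.comp (continuous_vadd X g)).div_const _
  have hmain : ∀ m : ℕ, ∀ᶠ x in residual X.carrier,
      ∃ n ≥ m, |averageAlong P f n x - z| < 1 / ((m : ℝ) + 1) := by
    intro m
    refine residual_of_dense_open ?_ ?_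
    · have : {x : X.carrier | ∃ n ≥ m, |averageAlong P f n x - z| < 1 / ((m : ℝ) + 1)} =
          ⋃ n ≥ m, {x | |averageAlong P f n x - z| < 1 / ((m : ℝ) + 1)} := by
        ext x; simp
      rw [this]
      exact isOpen_biUnion fun n _ =>
        isOpen_lt ((hcont n).sub continuous_const).abs continuous_const
    · refine dense_iff_inter_open.2 fun U hU hne => ?_
      obtain ⟨x, hxU⟩ := hne
      obtain ⟨V, hV, hVU⟩ := mem_nhds_induced Subtype.val x U |>.1 (hU.mem_nhds hxU)
      obtain ⟨N, hN⟩ := exists_window_subset_of_mem_nhds hV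
      obtain ⟨y, hyX, hyx, D, hD⟩ := hX x.1 x.2 N
      refine ⟨⟨y, hyX⟩, hVU (hN y hyx), ?_⟩
      have hlim := tendsto_averageAlong (x := ⟨y, hyX⟩) hinf hf hD
      have hpos : (0 : ℝ) < 1 / ((m : ℝ) + 1) := by positivity
      obtain ⟨n, hn, hnm⟩ := ((Metric.tendsto_nhds.1 hlim _ hpos).and
        (eventually_ge_atTop m)).exists
      exact ⟨n, hnm, hn⟩
  filter_upwards [eventually_countable_forall.2 hmain] with x hx ε hε
  refine frequently_atTop.2 fun a => ?_
  obtain ⟨b, hb⟩ := exists_nat_one_div_lt hε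
  obtain ⟨n, hn, hlt⟩ := hx (max a b)
  refine ⟨n, (le_max_left a b).trans hn, hlt.trans (lt_of_le_of_lt ?_ hb)⟩
  have : (b : ℝ) ≤ (max a b : ℕ) := by exact_mod_cast le_max_right a b
  exact one_div_le_one_div_of_le (by positivity) (by linarith)

lemma averagesOscillate {X : Subshift C (Fin d → ℤ)} (hinf : P.Infinite)
    (hC : (C : Set ℝ) ⊆ Set.Icc 0 1) (h0 : 0 ∈ C) (h1 : 1 ∈ C)
    {f : C(X.carrier, ℝ)} (hf : ∀ x, f x = (x.1 0 : ℝ))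
    (hX : ∀ z : C, ∀ x ∈ X.carrier, ∀ N, ∃ y ∈ X.carrier, (∀ h ∈ window d N, y h = x h) ∧
      ∃ D : Finset (Fin d → ℤ), ∀ h ∈ P, h ∉ D → y h = z) :
    AveragesOscillate P f := by
  have hlim : ∀ᶠ x in residual X.carrier, liminf (fun n => averageAlong P f n x) atTop = 0 ∧
      limsup (fun n => averageAlong P f n x) atTop = 1 := by
    filter_upwards [eventually_residual_frequently hinf hf ⟨0, h0⟩ (hX _),
      eventually_residual_frequently hinf hf ⟨1, h1⟩ (hX _)] with x hx0 hx1
    have hmem : ∀ n, averageAlong P f n x ∈ Set.Icc 0 1 := fun n =>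
      averageAlong_mem_Icc hC hf n x
    have hbelow : IsBoundedUnder (· ≥ ·) atTop fun n => averageAlong P f n x :=
      isBoundedUnder_of ⟨0, fun n => (hmem n).1⟩
    have habove : IsBoundedUnder (· ≤ ·) atTop fun n => averageAlong P f n x :=
      isBoundedUnder_of ⟨1, fun n => (hmem n).2⟩
    constructor
    · refine le_antisymm (le_of_forall_pos_le_add fun ε hε => ?_)
        (le_liminf_of_le habove.isCoboundedUnder_ge (Eventually.of_forall fun n => (hmem n).1))
      refine liminf_le_of_frequently_le ((hx0 ε hε).mono fun n hn => ?_) hbelow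
      have := (abs_lt.1 hn).2
      linarith
    · refine le_antisymm
        (limsup_le_of_le hbelow.isCoboundedUnder_le (Eventually.of_forall fun n => (hmem n).2))
        (le_of_forall_pos_le_add fun ε hε => ?_)
      have : 1 - ε ≤ limsup (fun n => averageAlong P f n x) atTop := by
        refine le_limsup_of_frequently_le ((hx1 ε hε).mono fun n hn => ?_) habove
        have := (abs_lt.1 hn).1
        linarith
      linarith
  refine ⟨?_, hlim⟩
  filter_upwards [hlim] with x hx
  rintro ⟨L, hL⟩
  have h2 := hL.liminf_eq.symm.trans hx.1
  have h3 := hL.limsup_eq.symm.trans hx.2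
  exact zero_ne_one (h2.symm.trans h3)

/-- The construction over a given alphabet. -/
lemma exists_oscillating_subshift (hd : 1 ≤ d) (hinf : P.Infinite) (hP : IsSparse P)
    (hC : (C : Set ℝ) ⊆ Set.Icc 0 1) (h0 : 0 ∈ C) (h1 : 1 ∈ C) :
    ∃ X : Subshift C (Fin d → ℤ), IsTotallyStrictlyErgodic (Fin d → ℤ) X.carrier ∧
      (∃ h : ℝ, HasTopologicalEntropy X h ∧ Real.log (C.card / 2) / 2 ^ d ≤ h) ∧
      ∃ f : C(X.carrier, ℝ), (∀ x, f x = (x.1 0 : ℝ)) ∧ AveragesOscillate P f := by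
  have : Nonempty C := ⟨⟨0, h0⟩⟩
  refine ⟨hierarchySubshift C P, isTotallyStrictlyErgodic_hierarchySubshift hd hP, ?_,
    ⟨fun x => (x.1 0 : ℝ), continuous_subtype_val.comp
      ((continuous_apply 0).comp continuous_subtype_val)⟩, fun _ => rfl, ?_⟩
  · obtain ⟨h, hh⟩ := exists_hasTopologicalEntropy (hierarchySubshift C P)
      (hierarchySubshift_nonempty hd hP)
    refine ⟨h, hh, ?_⟩
    have hcard : 2 ≤ Fintype.card C := by
      rw [Fintype.card_coe]
      exact Finset.one_lt_card.2 ⟨0, h0, 1, h1, zero_ne_one⟩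
    have := le_entropy hd hP hcard hh
    rwa [Fintype.card_coe] at this
  · exact averagesOscillate hinf hC h0 h1 (fun _ => rfl) fun z x hx N =>
      exists_mem_eqOn_window hd hP hx N fun _ => z

end

end

theorem theorem2 (d : ℕ) (hd : 1 ≤ d) (P : Set (Fin d → ℤ)) (hinf : P.Infinite)
    (hP : upperBanachDensity P = 0) :
    (∃ X : Subshift ({0, 1} : Finset ℝ) (Fin d → ℤ),
      IsTotallyStrictlyErgodic (Fin d → ℤ) X.carrier ∧
      ∃ f : C(X.carrier, ℝ), (∀ x, f x = (x.1 0 : ℝ)) ∧ AveragesOscillate P f) ∧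
    (∀ M : ℝ, ∃ C : Finset ℝ, 0 ∈ C ∧ 1 ∈ C ∧ (C : Set ℝ) ⊆ Set.Icc 0 1 ∧
      ∃ X : Subshift C (Fin d → ℤ),
        IsTotallyStrictlyErgodic (Fin d → ℤ) X.carrier ∧
        (∃ h : ℝ, HasTopologicalEntropy X h ∧ M ≤ h) ∧
        ∃ f : C(X.carrier, ℝ), (∀ x, f x = (x.1 0 : ℝ)) ∧ AveragesOscillate P f) := by
  have hsparse := isSparse_of_upperBanachDensity_eq_zero hP
  refine ⟨?_, fun M => ?_⟩
  · obtain ⟨X, h1, -, h2⟩ := exists_oscillating_subshift (C := {0, 1}) hd hinf hsparse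
      (by intro x hx; simp at hx; rcases hx with rfl | rfl <;> simp) (by simp) (by simp)
    exact ⟨X, h1, h2⟩
  · obtain ⟨m, hm⟩ := exists_nat_ge (2 * Real.exp (M * 2 ^ d))
    have hmpos : (0 : ℝ) < m := lt_of_lt_of_le (by positivity) hm
    let C : Finset ℝ := (Finset.range (m + 1)).image fun i : ℕ => (i : ℝ) / m
    have hcard : C.card = m + 1 := by
      rw [Finset.card_image_of_injective, Finset.card_range]
      intro i j hij
      exact_mod_cast (div_left_inj' hmpos.ne').1 hij
    have h0 : 0 ∈ C := Finset.mem_image.2 ⟨0, by simp, by simp⟩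
    have h1 : 1 ∈ C := Finset.mem_image.2 ⟨m, by simp, div_self hmpos.ne'⟩
    have hC : (C : Set ℝ) ⊆ Set.Icc 0 1 := by
      intro x hx
      obtain ⟨i, hi, rfl⟩ := Finset.mem_image.1 (Finset.mem_coe.1 hx)
      have : (i : ℝ) ≤ m := by exact_mod_cast Nat.lt_succ_iff.1 (Finset.mem_range.1 hi)
      exact ⟨by positivity, (div_le_one hmpos).2 this⟩
    obtain ⟨X, h2, ⟨h, hh, hle⟩, h3⟩ := exists_oscillating_subshift hd hinf hsparse hC h0 h1
    refine ⟨C, h0, h1, hC, X, h2, ⟨h, hh, le_trans ?_ hle⟩, h3⟩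
    rw [le_div_iff₀ (by positivity), hcard, Real.le_log_iff_exp_le (by positivity)]
    push_cast
    linarith
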